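/- Let $p$ be a prime number. Let $k$ be a (not necessarily perfect) field of characteristic $p$, and let $C(k)$ be the Cohen ring of $k$, i.e. a complete discrete valuation ring with maximal ideal $pC(k)$ and $C(k)/pC(k)\cong k$. Fix a $\delta$-structure on $C(k)$, with Frobenius lift $\varphi(a)=a^p+p\,\delta(a)$, and fix an integer $d\ge 0$. Put $A = C(k)[[T_1,\dots,T_d]]$, equipped with the $\delta$-structure whose Frobenius lift $\varphi$ extends the one of $C(k)$ and satisfies $\varphi(T_i)=T_i^p$ for all $i$. For an ideal $I\subseteq A$, the pair $(A,I)$ is called a prism if $I$ is a locally free $A$-module of rank $1$, $A$ is derived $(p,I)$-complete, and $p\in I+\varphi(I)A$. Let $\mathscr{R}$ be the set of complete regular local rings of dimension $d$ with residue field (isomorphic to) $k$, up to isomorphism of rings. Let $\mathscr{I}$ be the set of ideals $I$ of $A$ such that $(A,I)$ is a prism, modulo the equivalence relation $I\sim I'$ if and only if there is an automorphism $f$ of the ring $A$ (not necessarily compatible with the $\delta$-structure) with $f(I')=I$. Then for every ideal $I$ of $A$ such that $(A,I)$ is a prism, the ring $A/I$ is a complete regular local ring of dimension $d$ with residue field $k$,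 and $I\mapsto A/I$ induces a well-defined bijection $\mathscr{I}\to\mathscr{R}$. -/

import Mathlib

universe u v

/-- A `δ`-structure (with respect to the prime `p`) on a commutative ring `A`. The integer
`p.choose i / p` is exact for `0 < i < p`, so the sum in `map_add` is
`((a + b) ^ p - a ^ p - b ^ p) / p`. -/
structure DeltaStructure (p : ℕ) (A : Type*) [CommRing A] where
  /-- The underlying map of sets. -/
  δ : A → A
  map_zero : δ 0 = 0
  map_one : δ 1 = 0
  map_add : ∀ a b : A, δ (a + b) = δ a + δ b -
    ∑ i ∈ Finset.Ioo 0 p, ((p.choose i / p : ℕ) : A) * a ^ i * b ^ (p - i)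
  map_mul : ∀ a b : A, δ (a * b) = a ^ p * δ b + b ^ p * δ a + p * δ a * δ b

/-- The integral form of the binomial theorem for a prime exponent. -/
theorem add_pow_prime_eq_deltaSum {A : Type*} [CommRing A] {p : ℕ} (hp : p.Prime) (a b : A) :
    (a + b) ^ p = a ^ p + b ^ p +
      p * ∑ i ∈ Finset.Ioo 0 p, ((p.choose i / p : ℕ) : A) * a ^ i * b ^ (p - i) := by
  rw [add_pow_prime_eq hp, mul_assoc (p : A) a b, mul_assoc (p : A)]
  congr 2
  rw [Finset.mul_sum]
  refine Finset.sum_congr rfl fun i hi => ?_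
  obtain ⟨h1, h2⟩ := Finset.mem_Ioo.mp hi
  obtain ⟨j, rfl⟩ := Nat.exists_eq_add_of_lt h1
  obtain ⟨m, rfl⟩ := Nat.exists_eq_add_of_lt h2
  have e1 : 0 + j + 1 - 1 = j := by omega
  have e2 : 0 + j + 1 + m + 1 - (0 + j + 1) = m + 1 := by omega
  have e3 : 0 + j + 1 + m + 1 - (0 + j + 1) - 1 = m := by omega
  rw [e1, e3, e2]
  ring

namespace DeltaStructure

variable {p : ℕ} {A : Type*} [CommRing A]

/-- The Frobenius lift `φ(a) = a ^ p + p δ(a)`, as a map of sets. -/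
def φ (D : DeltaStructure p A) (a : A) : A := a ^ p + p * D.δ a

/-- The Frobenius lift, as a ring endomorphism. -/
def frobeniusLift (hp : p.Prime) (D : DeltaStructure p A) : A →+* A where
  toFun := D.φ
  map_zero' := by simp [φ, D.map_zero, hp.ne_zero]
  map_one' := by simp [φ, D.map_one]
  map_add' a b := by
    simp only [φ, D.map_add, add_pow_prime_eq_deltaSum hp]
    ring
  map_mul' a b := by
    simp only [φ, D.map_mul]
    ring

/-- On a `p`-torsion-free ring, a ring endomorphism lifting the Frobenius map modulo `p` gives a
`δ`-structure, by `δ(a) = (φ(a) - a ^ p) / p`. -/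
noncomputable def ofFrobeniusLift (hp : p.Prime) (hA : (p : A) ∈ nonZeroDivisors A)
    (F : A →+* A) (hF : ∀ a, (p : A) ∣ F a - a ^ p) : DeltaStructure p A where
  δ a := (hF a).choose
  map_zero := by
    have h := (hF 0).choose_spec
    refine (mul_right_mem_nonZeroDivisors_eq_zero_iff hA).mp ?_
    rw [mul_comm, ← h]
    simp [hp.ne_zero]
  map_one := by
    have h := (hF 1).choose_spec
    refine (mul_right_mem_nonZeroDivisors_eq_zero_iff hA).mp ?_
    rw [mul_comm, ← h]
    simp
  map_add a b := by
    refine (mul_cancel_left_mem_nonZeroDivisors hA).mp ?_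
    rw [mul_sub, mul_add, ← (hF (a + b)).choose_spec, ← (hF a).choose_spec,
      ← (hF b).choose_spec, _root_.map_add, add_pow_prime_eq_deltaSum hp]
    ring
  map_mul a b := by
    refine (mul_cancel_left_mem_nonZeroDivisors hA).mp ?_
    have ha := (hF a).choose_spec
    have hb := (hF b).choose_spec
    rw [← (hF (a * b)).choose_spec, _root_.map_mul]
    linear_combination (F b) * ha + (a ^ p + p * (hF a).choose) * hb

theorem φ_ofFrobeniusLift (hp : p.Prime) (hA : (p : A) ∈ nonZeroDivisors A)
    (F : A →+* A) (hF : ∀ a, (p : A) ∣ F a - a ^ p) (a : A) :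
    (ofFrobeniusLift hp hA F hF).φ a = F a := by
  have h := (hF a).choose_spec
  change a ^ p + p * (hF a).choose = F a
  rw [← h]
  ring

theorem dvd_frobeniusLift (hp : p.Prime) (D : DeltaStructure p A) (a : A) :
    (p : A) ∣ D.frobeniusLift hp a - a ^ p :=
  ⟨D.δ a, by change a ^ p + p * D.δ a - a ^ p = _; ring⟩

/-- The endomorphism of `A[[T_i]]` which is the Frobenius lift of `A` on the coefficients and sends
each variable `T_i` to `T_i ^ p`. -/
noncomputable def powerSeriesFrobenius (hp : p.Prime) (D : DeltaStructure p A)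
    (σ : Type*) [Finite σ] : MvPowerSeries σ A →+* MvPowerSeries σ A :=
  (MvPowerSeries.expand p hp.ne_zero : MvPowerSeries σ A →ₐ[A] _).toRingHom.comp
    (MvPowerSeries.map (D.frobeniusLift hp))

theorem powerSeriesFrobenius_C (hp : p.Prime) (D : DeltaStructure p A)
    (σ : Type*) [Finite σ] (a : A) :
    D.powerSeriesFrobenius hp σ (MvPowerSeries.C a) = MvPowerSeries.C (D.φ a) := by
  change MvPowerSeries.expand p hp.ne_zero (MvPowerSeries.map _ (MvPowerSeries.C a)) = _
  rw [MvPowerSeries.map_C, MvPowerSeries.expand_C]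
  rfl

theorem powerSeriesFrobenius_X (hp : p.Prime) (D : DeltaStructure p A)
    (σ : Type*) [Finite σ] (i : σ) :
    D.powerSeriesFrobenius hp σ (MvPowerSeries.X i) = MvPowerSeries.X i ^ p := by
  change MvPowerSeries.expand p hp.ne_zero (MvPowerSeries.map _ (MvPowerSeries.X i)) = _
  rw [MvPowerSeries.map_X, MvPowerSeries.expand_X]

theorem dvd_powerSeriesFrobenius (hp : p.Prime) (D : DeltaStructure p A)
    (σ : Type*) [Finite σ] (f : MvPowerSeries σ A) :
    (p : MvPowerSeries σ A) ∣ D.powerSeriesFrobenius hp σ f - f ^ p := by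
  have key : MvPowerSeries.map (Ideal.Quotient.mk (Ideal.span {(p : A)}))
      (D.powerSeriesFrobenius hp σ f - f ^ p) = 0 := by
    by_cases hu : IsUnit (p : A)
    · have : Subsingleton (A ⧸ Ideal.span {(p : A)}) := by
        rw [Ideal.Quotient.subsingleton_iff, Ideal.span_singleton_eq_top]
        exact hu
      ext n
      exact Subsingleton.elim _ _
    · have : Fact p.Prime := ⟨hp⟩
      have : CharP (A ⧸ Ideal.span {(p : A)}) p := CharP.quotient A p hu
      have : ExpChar (A ⧸ Ideal.span {(p : A)}) p := ExpChar.prime hp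
      have hc : (Ideal.Quotient.mk (Ideal.span {(p : A)})).comp (D.frobeniusLift hp) =
          (frobenius (A ⧸ Ideal.span {(p : A)}) p).comp (Ideal.Quotient.mk _) := by
        ext a
        rw [RingHom.comp_apply, RingHom.comp_apply, frobenius_def, ← map_pow,
          Ideal.Quotient.eq, Ideal.mem_span_singleton]
        exact D.dvd_frobeniusLift hp a
      rw [map_sub, map_pow, sub_eq_zero]
      change MvPowerSeries.map _ (MvPowerSeries.expand p hp.ne_zero (MvPowerSeries.map _ f)) = _
      rw [MvPowerSeries.map_expand, ← RingHom.comp_apply (MvPowerSeries.map _),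
        ← MvPowerSeries.map_comp, hc, MvPowerSeries.map_comp, RingHom.comp_apply,
        ← MvPowerSeries.map_expand, MvPowerSeries.map_frobenius_expand]
  have hcoeff : ∀ n, ∃ c : A, (p : A) * c =
      MvPowerSeries.coeff n (D.powerSeriesFrobenius hp σ f - f ^ p) := fun n => by
    have h := congrArg (MvPowerSeries.coeff n) key
    rw [MvPowerSeries.coeff_map, _root_.map_zero, Ideal.Quotient.eq_zero_iff_mem,
      Ideal.mem_span_singleton] at h
    obtain ⟨c, hc⟩ := h
    exact ⟨c, hc.symm⟩
  choose g hg using hcoeff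
  let G : MvPowerSeries σ A := g
  have hG : ∀ n, MvPowerSeries.coeff n G = g n := fun n => rfl
  refine ⟨G, ?_⟩
  ext n
  have : (p : MvPowerSeries σ A) = MvPowerSeries.C (p : A) := by simp
  rw [this, MvPowerSeries.coeff_C_mul, ← hg n, hG]

theorem natCast_mem_nonZeroDivisors_mvPowerSeries (σ : Type*)
    (hA : (p : A) ∈ nonZeroDivisors A) :
    (p : MvPowerSeries σ A) ∈ nonZeroDivisors (MvPowerSeries σ A) := by
  rw [mem_nonZeroDivisors_iff_right]
  intro f hf
  ext n
  have h := congrArg (MvPowerSeries.coeff n) hf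
  have hC : (p : MvPowerSeries σ A) = MvPowerSeries.C (p : A) := by simp
  rw [hC, mul_comm, MvPowerSeries.coeff_C_mul, _root_.map_zero, mul_comm] at h
  rw [_root_.map_zero]
  exact (mul_right_mem_nonZeroDivisors_eq_zero_iff hA).mp h

/-- The `δ`-structure on the power series ring `A[[T_i]]` over a `p`-torsion-free `δ`-ring `A` whose
Frobenius lift extends the one of `A` and satisfies `φ(T_i) = T_i ^ p`. -/
noncomputable def mvPowerSeries (hp : p.Prime) (hA : (p : A) ∈ nonZeroDivisors A)
    (D : DeltaStructure p A) (σ : Type*) [Finite σ] : DeltaStructure p (MvPowerSeries σ A) :=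
  ofFrobeniusLift hp (natCast_mem_nonZeroDivisors_mvPowerSeries σ hA)
    (D.powerSeriesFrobenius hp σ) (D.dvd_powerSeriesFrobenius hp σ)

theorem φ_mvPowerSeries_C (hp : p.Prime) (hA : (p : A) ∈ nonZeroDivisors A)
    (D : DeltaStructure p A) (σ : Type*) [Finite σ] (a : A) :
    (D.mvPowerSeries hp hA σ).φ (MvPowerSeries.C a) = MvPowerSeries.C (D.φ a) :=
  (φ_ofFrobeniusLift ..).trans (D.powerSeriesFrobenius_C hp σ a)

theorem φ_mvPowerSeries_X (hp : p.Prime) (hA : (p : A) ∈ nonZeroDivisors A)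
    (D : DeltaStructure p A) (σ : Type*) [Finite σ] (i : σ) :
    (D.mvPowerSeries hp hA σ).φ (MvPowerSeries.X i) = MvPowerSeries.X i ^ p :=
  (φ_ofFrobeniusLift ..).trans (D.powerSeriesFrobenius_X hp σ i)

end DeltaStructure

/-- The module `M` is derived complete with respect to the ideal `J`: for every `f ∈ J` the derived
limit `R lim (⋯ → M → M → M)` along multiplication by `f` vanishes. This derived limit is computed
by the two-term complex `∏ₙ M → ∏ₙ M`, `(xₙ)ₙ ↦ (xₙ - f xₙ₊₁)ₙ`, so its vanishing means that this
map is bijective. -/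
def IsDerivedComplete {A : Type*} [CommRing A] (J : Ideal A) (M : Type*) [AddCommGroup M]
    [Module A M] : Prop :=
  ∀ f ∈ J, Function.Bijective fun (x : ℕ → M) (n : ℕ) => x n - f • x (n + 1)

/-- The module `M` is (Zariski-)locally free of rank `1`: the spectrum is covered by basic opens
`D(f)` over which `M` becomes free of rank `1`. -/
def IsLocallyFreeOfRankOne (A : Type*) [CommRing A] (M : Type*) [AddCommGroup M]
    [Module A M] : Prop :=
  ∃ s : Set A, Ideal.span s = ⊤ ∧ ∀ f ∈ s,
    Nonempty (LocalizedModule (Submonoid.powers f) M ≃ₗ[Localization (Submonoid.powers f)]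
      Localization (Submonoid.powers f))

/-- The pair `(A, I)` of a `δ`-ring `A` and an ideal `I` is a prism. -/
structure IsPrism {p : ℕ} {A : Type*} [CommRing A] (D : DeltaStructure p A) (I : Ideal A) :
    Prop where
  locallyFree : IsLocallyFreeOfRankOne A I
  derivedComplete : IsDerivedComplete (Ideal.span {(p : A)} ⊔ I) A
  mem : (p : A) ∈ I ⊔ Ideal.span (D.φ '' I)

/-- `C` is a Cohen ring of the field `k` of characteristic `p`: an absolutely unramified complete
discrete valuation ring with `C / pC` isomorphic to `k`. -/
structure IsCohenRing (p : ℕ) (k : Type*) [Field k] (C : Type*) [CommRing C] : Prop where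
  isDomain : IsDomain C
  isDiscreteValuationRing : IsDiscreteValuationRing C
  maximalIdeal_eq : IsLocalRing.maximalIdeal C = Ideal.span {(p : C)}
  isAdicComplete : IsAdicComplete (IsLocalRing.maximalIdeal C) C
  residue : Nonempty ((C ⧸ Ideal.span {(p : C)}) ≃+* k)

theorem IsCohenRing.natCast_mem_nonZeroDivisors {p : ℕ} {k : Type*} [Field k] {C : Type*}
    [CommRing C] (h : IsCohenRing p k C) : (p : C) ∈ nonZeroDivisors C := by
  have := h.isDomain
  have := h.isDiscreteValuationRing
  refine mem_nonZeroDivisors_of_ne_zero fun h0 => ?_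
  refine IsDiscreteValuationRing.not_a_field C ?_
  rw [h.maximalIdeal_eq, h0, Ideal.span_singleton_eq_bot]

/-- `R` is a complete regular local ring of dimension `d` with residue field (isomorphic to) `k`. -/
structure IsCompleteRegularLocalRing (k : Type*) [Field k] (d : ℕ) (R : Type*) [CommRing R] :
    Prop where
  isRegularLocalRing : IsRegularLocalRing R
  isAdicComplete : IsAdicComplete (IsLocalRing.maximalIdeal R) R
  ringKrullDim_eq : ringKrullDim R = d
  residue : Nonempty (IsLocalRing.ResidueField R ≃+* k)

/-- The complete regular local rings of dimension `d` with residue field `k`. -/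
structure CompleteRegularLocalRing (k : Type v) [Field k] (d : ℕ) : Type (max v (u + 1)) where
  carrier : Type u
  [commRing : CommRing carrier]
  property : IsCompleteRegularLocalRing k d carrier

attribute [instance] CompleteRegularLocalRing.commRing

/-- Isomorphism of rings, on complete regular local rings. -/
instance CompleteRegularLocalRing.setoid (k : Type v) [Field k] (d : ℕ) :
    Setoid (CompleteRegularLocalRing.{u, v} k d) where
  r R S := Nonempty (R.carrier ≃+* S.carrier)
  iseqv :=
    { refl := fun R => ⟨RingEquiv.refl R.carrier⟩
      symm := fun ⟨e⟩ => ⟨e.symm⟩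
      trans := fun ⟨e⟩ ⟨f⟩ => ⟨e.trans f⟩ }

/-- The ideals `I` for which `(A, I)` is a prism. -/
def PrismIdeal {p : ℕ} {A : Type u} [CommRing A] (D : DeltaStructure p A) : Type u :=
  {I : Ideal A // IsPrism D I}

/-- `I ∼ I'` if `f(I') = I` for some ring automorphism `f` of `A`. -/
instance PrismIdeal.setoid {p : ℕ} {A : Type u} [CommRing A] (D : DeltaStructure p A) :
    Setoid (PrismIdeal D) where
  r I I' := ∃ f : A ≃+* A, I'.1.map f = I.1
  iseqv :=
    { refl := fun I => ⟨RingEquiv.refl A, Ideal.map_id I.1⟩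
      symm := by
        rintro I I' ⟨f, hf⟩
        refine ⟨f.symm, ?_⟩
        rw [← hf]
        exact Ideal.map_of_equiv f
      trans := by
        rintro I I' I'' ⟨f, hf⟩ ⟨g, hg⟩
        refine ⟨g.trans f, ?_⟩
        rw [← hf, ← hg]
        exact (Ideal.map_map (g : A →+* A) (f : A →+* A)).symm }

/-!
Write `A = C[[T₁, …, T_d]]`, with maximal ideal `m = (p, T₁, …, T_d)`.

**Prism ideals.** Call `ξ ∈ A` distinguished if its constant coefficient is `p` times a unit. The
ideals `I` for which `(A, I)` is a prism are exactly those generated by a distinguished `ξ`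
(`IsPrism.exists_isDistinguished`, `IsDistinguished.isPrism`). Indeed `I` is principal as `A` is
local, and it is proper by derived completeness. If the constant coefficient of `ξ` were divisible
by `p²`, so would be those of all elements of `I + φ(I)A`, and `p` could not be one of them.
Conversely, `δ(ξ)` is a unit for distinguished `ξ`, and `p δ(ξ) = φ(ξ) - ξ ^ p`.

**The quotient is regular.** Modulo a distinguished `ξ` the prime `p` lies in `(T₁, …, T_d)`, so `d`
elements generate the maximal ideal of `A / ξ`, whose dimension is at least `dim A - 1 ≥ d`.

**Lifting along the Cohen ring.** The rest depends on the fact that a homomorphism `C → S / J`, with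
`S` a complete Noetherian local ring, lifts to `S` (`exists_lift_of_isAdicComplete`). By completeness
it suffices to split a square-zero extension `E → C` whose kernel is killed by `p`. As `C` is
`p`-torsion-free, this amounts to splitting the extension `E / p → C / p` of a field `k` of
characteristic `p` (`exists_section_of_sq_zero_of_charP`). There, a subring of `E / p` that is maximal
among those which contain all `p`-th powers and meet the kernel in `0` is mapped isomorphically
onto `k`: an `x ∈ k` outside its image has minimal polynomial `X ^ p - x ^ p` over the image, so
any lift of `x` could be adjoined. This is the formal smoothness of `k` over its prime field; no
perfectness or finiteness is needed.

**Surjectivity.** Let `R` be complete regular local of dimension `d` with residue field `k`. Lift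
`C → k` to `C → R` and send the `T_i` to generators `x_i` of the maximal ideal. The resulting map
`A → R` is surjective. Writing `p = ∑ rᵢ xᵢ` and lifting the `rᵢ` to `aᵢ ∈ A`, the distinguished
element `ξ = p - ∑ aᵢ Tᵢ` lies in the kernel. Since `A / ξ` is regular, it is a domain
(`isDomain_of_span_range_eq_maximalIdeal`), and it has the same dimension as `R`, so `A / ξ ≅ R`.

**Injectivity.** An isomorphism `A / ξ' ≅ A / ξ` lifts to an endomorphism `f` of `A`, by the lifting
property on `C` and arbitrarily on the `T_i`. If `f(ξ') ∉ m²`, then `f(ξ')` is a unit times `ξ`, so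
`f(m)` generates `m`, and `f` is surjective by completeness, hence bijective. Changing the lift of
one `T_j` by `ξ` if necessary achieves `f(ξ') ∉ m²` (`exists_ringHom_lift_notMem_sq`).
-/

open IsLocalRing

/-! ### Lifting homomorphisms from a Cohen ring -/

theorem exists_section_of_subring {E B : Type*} [CommRing E] [CommRing B] (ρ : E →+* B)
    (T : Subring E) (hinj : ∀ x ∈ T, ρ x = 0 → x = 0) (hsurj : ∀ b, ∃ x ∈ T, ρ x = b) :
    ∃ s : B →+* E, ∀ b, ρ (s b) = b := by
  let e : T ≃+* B := RingEquiv.ofBijective (ρ.comp T.subtype)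
    ⟨(injective_iff_map_eq_zero _).2 fun x hx => Subtype.ext (hinj x x.2 hx),
      fun b => by obtain ⟨x, hx, h⟩ := hsurj b; exact ⟨⟨x, hx⟩, h⟩⟩
  exact ⟨T.subtype.comp e.symm, fun b => e.apply_symm_apply b⟩

/-- Let `S ⊆ E` be a subring that contains all `p`-th powers and is mapped injectively to the field
`k`. If `ρ e` is not in the image of `S`, then `S[e]` is mapped injectively to `k` as well: the image
`L` of `S` is a field, and `X ^ p - (ρ e) ^ p` is the minimal polynomial of `ρ e` over `L`. -/
theorem adjoin_root_inter_ker_eq_bot (p : ℕ) [Fact p.Prime] {E k : Type*} [CommRing E] [Field k]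
    [CharP E p] {ρ : E →+* k} (hρ : Function.Surjective ρ) {S : Subring E}
    (hfrob : ∀ x, x ^ p ∈ S) (hS : ∀ x ∈ S, ρ x = 0 → x = 0) {e : E}
    (he : ∀ x ∈ S, ρ x ≠ ρ e) (F : Polynomial S)
    (hF : ρ (F.eval₂ S.subtype e) = 0) : F.eval₂ S.subtype e = 0 := by
  have hp : p.Prime := Fact.out
  have : CharP k p := (CharP.charP_iff_prime_eq_zero hp).2 (by
    rw [← map_natCast ρ, CharP.cast_eq_zero, map_zero])
  have : Nontrivial S := (ρ.comp S.subtype).domain_nontrivial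
  let L : Subfield k :=
    { S.map ρ with
      inv_mem' := by
        rintro _ ⟨x, hx, rfl⟩
        obtain ⟨y, hy⟩ := hρ (ρ x)⁻¹
        -- `b⁻¹ = b ^ (p - 1) * (b⁻¹) ^ p`, and `S` contains the `p`-th power of a lift of `b⁻¹`.
        refine ⟨x ^ (p - 1) * y ^ p, S.mul_mem (S.pow_mem hx _) (hfrob y), ?_⟩
        rw [map_mul, map_pow, map_pow, hy]
        by_cases h0 : ρ x = 0
        · simp [h0, hp.ne_zero]
        · obtain ⟨n, hn⟩ := Nat.exists_eq_succ_of_ne_zero hp.ne_zero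
          rw [hn, Nat.succ_sub_one, pow_succ, ← mul_assoc, ← mul_pow, mul_inv_cancel₀ h0,
            one_pow, one_mul] }
  let σ : S →+* L := (ρ.comp S.subtype).codRestrict L fun x => ⟨x, x.2, rfl⟩
  have hσ : Function.Injective σ := (injective_iff_map_eq_zero _).2 fun x hx =>
    Subtype.ext (hS x x.2 (congrArg Subtype.val hx))
  have hcomp : (algebraMap L k).comp σ = ρ.comp S.subtype := rfl
  let g : Polynomial S := Polynomial.X ^ p - Polynomial.C ⟨e ^ p, hfrob e⟩
  have hg : g.Monic := Polynomial.monic_X_pow_sub_C _ hp.ne_zero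
  have hge : g.eval₂ S.subtype e = 0 := by simp [g]
  -- Reduction modulo `g` does not change the value at `e`, and makes the degree smaller than `p`.
  have hred : (F %ₘ g).eval₂ S.subtype e = F.eval₂ S.subtype e := by
    conv_rhs => rw [← Polynomial.modByMonic_add_div F g]
    rw [Polynomial.eval₂_add, Polynomial.eval₂_mul, hge, zero_mul, add_zero]
  have hirr : Irreducible (g.map σ) := by
    have : g.map σ = Polynomial.X ^ p - Polynomial.C (σ ⟨e ^ p, hfrob e⟩) := by simp [g]
    rw [this]
    refine X_pow_sub_C_irreducible_of_prime hp fun b hb => ?_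
    obtain ⟨x, hx, hxb⟩ := b.2
    refine he x hx ?_
    apply frobenius_inj k p
    rw [frobenius_def, frobenius_def, hxb, ← map_pow]
    exact congrArg Subtype.val hb
  have hmin : g.map σ = minpoly L (ρ e) := by
    refine minpoly.eq_of_irreducible_of_monic hirr ?_ (hg.map σ)
    rw [Polynomial.aeval_def, Polynomial.eval₂_map, hcomp, ← Polynomial.hom_eval₂, hge, map_zero]
  -- A nonzero polynomial with root `ρ e` has degree at least `p`.
  have hzero : (F %ₘ g).map σ = 0 := by
    by_contra hne
    have h := minpoly.degree_le_of_ne_zero L (ρ e) hne (by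
      rw [Polynomial.aeval_def, Polynomial.eval₂_map, hcomp, ← Polynomial.hom_eval₂, hred, hF])
    rw [← hmin, hg.degree_map, Polynomial.degree_map_eq_of_injective hσ] at h
    exact absurd (Polynomial.degree_modByMonic_lt F hg) (not_lt.2 h)
  rw [← hred, (Polynomial.map_eq_zero_iff hσ).1 hzero, Polynomial.eval₂_zero]

/-- A square-zero extension, of characteristic `p`, of a field splits. This is the formal smoothness
of an arbitrary field over its prime field. -/
theorem exists_section_of_sq_zero_of_charP (p : ℕ) [Fact p.Prime] {E k : Type*} [CommRing E]
    [Field k] [CharP E p] {ρ : E →+* k} (hρ : Function.Surjective ρ)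
    (hker : ∀ x y, ρ x = 0 → ρ y = 0 → x * y = 0) :
    ∃ s : k →+* E, ∀ a, ρ (s a) = a := by
  have hp : p.Prime := Fact.out
  let P : Set (Subring E) := {S | (∀ x, x ^ p ∈ S) ∧ ∀ x ∈ S, ρ x = 0 → x = 0}
  have hP0 : (frobenius E p).range ∈ P := by
    refine ⟨fun x => ⟨x, rfl⟩, ?_⟩
    rintro _ ⟨y, rfl⟩ hy
    rw [frobenius_def, map_pow] at hy
    have hy0 := eq_zero_of_pow_eq_zero hy
    rw [frobenius_def, ← Nat.sub_add_cancel hp.two_le, pow_add, pow_two, hker y y hy0 hy0, mul_zero]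
  obtain ⟨S, -, hS⟩ := zorn_le_nonempty₀ P (fun c hc hchain y hy => by
    refine ⟨sSup c, ⟨fun x => ?_, fun x hx h0 => ?_⟩, fun z hz => le_sSup hz⟩
    · exact le_sSup hy ((hc hy).1 x)
    · obtain ⟨T, hT, hxT⟩ := (Subring.mem_sSup_of_directedOn ⟨y, hy⟩ hchain.directedOn).1 hx
      exact (hc hT).2 x hxT h0) _ hP0
  refine exists_section_of_subring ρ S hS.prop.2 fun a => ?_
  by_contra! hne
  obtain ⟨e, rfl⟩ := hρ a
  let φ := Polynomial.eval₂RingHom S.subtype e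
  have hle : S ≤ φ.range := fun x hx => ⟨Polynomial.C ⟨x, hx⟩, by simp [φ]⟩
  have hmem : φ.range ∈ P := by
    refine ⟨fun x => hle (hS.prop.1 x), ?_⟩
    rintro _ ⟨F, rfl⟩ hF
    exact adjoin_root_inter_ker_eq_bot p hρ hS.prop.1 hS.prop.2 hne F hF
  exact hne e (hS.le_of_ge hmem hle ⟨Polynomial.X, by simp [φ]⟩) rfl

/-- Let `C` be `p`-torsion-free with `C / p` a field. A square-zero extension `E → C` whose kernel is
killed by `p` splits: it is the pullback of `E / p → C / p` along `C → C / p`, since the kernel meets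
`pE` in `0`. -/
theorem exists_section_of_sq_zero {p : ℕ} [Fact p.Prime] {C E : Type*} [CommRing C] [CommRing E]
    (hp0 : (p : C) ∈ nonZeroDivisors C) (hmax : (Ideal.span {(p : C)}).IsMaximal)
    {ρ : E →+* C} (hρ : Function.Surjective ρ)
    (hker : ∀ x y, ρ x = 0 → ρ y = 0 → x * y = 0) (hpker : ∀ x, ρ x = 0 → p * x = 0) :
    ∃ s : C →+* E, ∀ c, ρ (s c) = c := by
  let I : Ideal E := Ideal.span {(p : E)}
  let J : Ideal C := Ideal.span {(p : C)}
  let _ : Field (C ⧸ J) := Ideal.Quotient.field J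
  have hIJ : I ≤ J.comap ρ := by
    rw [Ideal.span_singleton_le_iff_mem, Ideal.mem_comap, map_natCast]
    exact Ideal.mem_span_singleton_self _
  have hu : ¬ IsUnit (p : E) := fun h => hmax.ne_top (by
    rw [Ideal.span_singleton_eq_top]; simpa using h.map ρ)
  have : CharP (E ⧸ I) p := CharP.quotient E p hu
  let ρ' : E ⧸ I →+* C ⧸ J := Ideal.quotientMap J ρ hIJ
  have hρ' : Function.Surjective ρ' := Ideal.quotientMap_surjective hρ
  have hmk : ∀ e, ρ' (Ideal.Quotient.mk I e) = Ideal.Quotient.mk J (ρ e) := fun e => rfl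
  have hI : ∀ e, Ideal.Quotient.mk I (p * e) = 0 := fun e =>
    Ideal.Quotient.eq_zero_iff_mem.2 (Ideal.mem_span_singleton.2 (dvd_mul_right _ _))
  have hadj : ∀ e c, Ideal.Quotient.mk J (ρ e) = Ideal.Quotient.mk J c →
      ∃ e', ρ (e - p * e') = c := fun e c h => by
    obtain ⟨c', hc'⟩ := Ideal.mem_span_singleton.1 (Ideal.Quotient.eq.1 h)
    obtain ⟨e', rfl⟩ := hρ c'
    exact ⟨e', by rw [map_sub, map_mul, map_natCast, ← hc', sub_sub_cancel]⟩
  have hrep : ∀ x, ρ' x = 0 → ∃ e, ρ e = 0 ∧ Ideal.Quotient.mk I e = x := fun x hx => by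
    obtain ⟨e, rfl⟩ := Ideal.Quotient.mk_surjective x
    obtain ⟨e', he'⟩ := hadj e 0 (by rw [← hmk, hx, map_zero])
    exact ⟨_, he', by rw [map_sub, hI, sub_zero]⟩
  obtain ⟨s', hs'⟩ := exists_section_of_sq_zero_of_charP p hρ' (fun x y hx hy => by
    obtain ⟨a, ha, rfl⟩ := hrep x hx
    obtain ⟨b, hb, rfl⟩ := hrep y hy
    rw [← map_mul, hker a b ha hb, map_zero])
  -- The section takes values in the `e` whose class modulo `p` is the one given by `s'`.
  refine exists_section_of_subring ρ ((Ideal.Quotient.mk I).eqLocus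
    ((s'.comp (Ideal.Quotient.mk J)).comp ρ)) (fun x hx h0 => ?_) (fun c => ?_)
  · have hx' : Ideal.Quotient.mk I x = s' (Ideal.Quotient.mk J (ρ x)) := hx
    rw [h0, map_zero, map_zero, Ideal.Quotient.eq_zero_iff_mem, Ideal.mem_span_singleton] at hx'
    obtain ⟨y, rfl⟩ := hx'
    rw [map_mul, map_natCast] at h0
    exact hpker y ((mul_right_mem_nonZeroDivisors_eq_zero_iff hp0).1 (by rwa [mul_comm]))
  · obtain ⟨e, he⟩ := Ideal.Quotient.mk_surjective (s' (Ideal.Quotient.mk J c))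
    obtain ⟨e', he'⟩ := hadj e c (by rw [← hmk, he, hs'])
    refine ⟨_, ?_, he'⟩
    change Ideal.Quotient.mk I (e - p * e') = s' (Ideal.Quotient.mk J (ρ (e - p * e')))
    rw [he', map_sub, hI, sub_zero, he]

/-- One step of the lifting of `g : C → S / J`: a homomorphism `f : C → S / m ^ (n + 1)` that agrees
with `g` modulo `J + m ^ (n + 1)` lifts to `S / m ^ (n + 2)`, with the analogous agreement. -/
theorem exists_lift_pow_succ {p : ℕ} [Fact p.Prime] {C S : Type*} [CommRing C] [CommRing S]
    (hp0 : (p : C) ∈ nonZeroDivisors C) (hmax : (Ideal.span {(p : C)}).IsMaximal)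
    {m J : Ideal S} (hpm : (p : S) ∈ m) (g : C →+* S ⧸ J) (n : ℕ)
    (f : C →+* S ⧸ m ^ (n + 1))
    (hf : ∀ c s t, f c = Ideal.Quotient.mk _ s → g c = Ideal.Quotient.mk _ t →
      s - t ∈ J ⊔ m ^ (n + 1)) :
    ∃ f' : C →+* S ⧸ m ^ (n + 2), (∀ c s t, f' c = Ideal.Quotient.mk _ s →
      g c = Ideal.Quotient.mk _ t → s - t ∈ J ⊔ m ^ (n + 2)) ∧
      (Ideal.Quotient.factorPow m (n + 1).le_succ).comp f' = f := by
  let B := S ⧸ m ^ (n + 2)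
  let q : B →+* S ⧸ m ^ (n + 1) := Ideal.Quotient.factorPow m (n + 1).le_succ
  let r : B →+* S ⧸ (J ⊔ m ^ (n + 2)) := Ideal.Quotient.factor le_sup_right
  let r' : S ⧸ J →+* S ⧸ (J ⊔ m ^ (n + 2)) := Ideal.Quotient.factor le_sup_left
  -- The pairs `(c, b)` such that `b` reduces to `f c` and agrees with `g c` modulo `J + m ^ (n + 2)`.
  -- The projection `E → C` is a square-zero extension; the second component of a section of it is the
  -- required lift.
  let E : Subring (C × B) :=
    (f.comp (RingHom.fst C B)).eqLocus (q.comp (RingHom.snd C B)) ⊓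
      ((r'.comp g).comp (RingHom.fst C B)).eqLocus (r.comp (RingHom.snd C B))
  let ρ : E →+* C := (RingHom.fst C B).comp E.subtype
  have hρ : Function.Surjective ρ := fun c => by
    obtain ⟨s, hs⟩ := Ideal.Quotient.mk_surjective (f c)
    obtain ⟨t, ht⟩ := Ideal.Quotient.mk_surjective (g c)
    obtain ⟨j, hj, y, hy, hjy⟩ := Submodule.mem_sup.1 (hf c s t hs.symm ht.symm)
    refine ⟨⟨(c, Ideal.Quotient.mk _ (s - y)), ?_, ?_⟩, rfl⟩
    · change f c = Ideal.Quotient.mk _ (s - y)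
      rw [← hs, Ideal.Quotient.eq, sub_sub_cancel]
      exact hy
    · change r' (g c) = Ideal.Quotient.mk _ (s - y)
      rw [← ht]
      refine Ideal.Quotient.eq.2 (Ideal.mem_sup_left ?_)
      have : t - (s - y) = -j := by linear_combination hjy
      rw [this]
      exact J.neg_mem hj
  have hrep : ∀ x : E, ρ x = 0 → ∃ s ∈ m ^ (n + 1), x.1 = (0, Ideal.Quotient.mk _ s) := by
    rintro ⟨⟨c, b⟩, h1, h2⟩ hx
    obtain rfl : c = 0 := hx
    obtain ⟨s, rfl⟩ := Ideal.Quotient.mk_surjective b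
    refine ⟨s, ?_, rfl⟩
    have h1' : f 0 = Ideal.Quotient.mk _ s := h1
    rw [map_zero] at h1'
    exact Ideal.Quotient.eq_zero_iff_mem.1 h1'.symm
  obtain ⟨σ, hσ⟩ := exists_section_of_sq_zero hp0 hmax hρ (fun x y hx hy => by
      obtain ⟨s, hs, hxs⟩ := hrep x hx
      obtain ⟨t, ht, hyt⟩ := hrep y hy
      refine Subtype.ext ?_
      rw [Subring.coe_mul, hxs, hyt, Prod.mk_mul_mk, mul_zero, ← map_mul]
      refine Prod.ext rfl (Ideal.Quotient.eq_zero_iff_mem.2 ?_)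
      refine Ideal.pow_le_pow_right ?_ (pow_add m (n + 1) (n + 1) ▸ Ideal.mul_mem_mul hs ht)
      lia)
    (fun x hx => by
      obtain ⟨s, hs, hxs⟩ := hrep x hx
      refine Subtype.ext ?_
      rw [Subring.coe_mul, hxs]
      refine Prod.ext (mul_zero _) (Ideal.Quotient.eq_zero_iff_mem.2 ?_ :
        Ideal.Quotient.mk (m ^ (n + 2)) (p * s) = 0)
      rw [pow_succ']
      exact Ideal.mul_mem_mul hpm hs)
  have h1 : ∀ c, (σ c).1.1 = c := hσ
  refine ⟨((RingHom.snd C B).comp E.subtype).comp σ, fun c s t hs ht => ?_, ?_⟩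
  · have h2 : r' (g (σ c).1.1) = r (σ c).1.2 := (σ c).2.2
    have hs' : (σ c).1.2 = Ideal.Quotient.mk _ s := hs
    rw [h1, ht, hs'] at h2
    exact Ideal.Quotient.eq.1 h2.symm
  · ext c
    have h2 : f (σ c).1.1 = q (σ c).1.2 := (σ c).2.1
    rw [h1] at h2
    exact h2.symm

/-- Homomorphisms from a Cohen ring to a quotient of a complete Noetherian local ring lift. -/
theorem exists_lift_of_isAdicComplete {p : ℕ} [Fact p.Prime] {C S : Type*} [CommRing C]
    [CommRing S] [IsLocalRing S] [IsNoetherianRing S] [IsAdicComplete (maximalIdeal S) S]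
    (hp0 : (p : C) ∈ nonZeroDivisors C) (hmax : (Ideal.span {(p : C)}).IsMaximal)
    (hpS : (p : S) ∈ maximalIdeal S) {J : Ideal S} (hJ : J ≤ maximalIdeal S) (g : C →+* S ⧸ J) :
    ∃ h : C →+* S, ∀ c, Ideal.Quotient.mk J (h c) = g c := by
  let m := maximalIdeal S
  let T (n : ℕ) := {f : C →+* S ⧸ m ^ (n + 1) // ∀ c s t, f c = Ideal.Quotient.mk _ s →
    g c = Ideal.Quotient.mk _ t → s - t ∈ J ⊔ m ^ (n + 1)}
  have hstep : ∀ n (f : T n), ∃ f' : T (n + 1),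
      (Ideal.Quotient.factorPow m (n + 1).le_succ).comp f'.1 = f.1 := fun n f => by
    obtain ⟨f', h, h'⟩ := exists_lift_pow_succ hp0 hmax hpS g n f.1 f.2
    exact ⟨⟨f', h⟩, h'⟩
  choose F hF using hstep
  -- The recursion starts at `S / m`, through which `S / J` factors; the kernel of
  -- `S / m → S / m ^ 0` is not square-zero.
  have hJm : J ≤ m ^ (0 + 1) := by simpa using hJ
  let f0 : T 0 := ⟨(Ideal.Quotient.factor hJm).comp g, fun c s t hs ht => by
    rw [RingHom.comp_apply, ht] at hs
    exact Ideal.mem_sup_right (Ideal.Quotient.eq.1 hs.symm)⟩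
  let f : ∀ n, T n := fun n => Nat.rec f0 F n
  have ha : StrictMono fun n : ℕ => n + 1 := fun a b h => Nat.succ_lt_succ h
  let h := IsAdicComplete.StrictMono.liftRingHom m ha (fun n => (f n).1) (fun {n} => hF n (f n))
  refine ⟨h, fun c => ?_⟩
  obtain ⟨t, ht⟩ := Ideal.Quotient.mk_surjective (g c)
  have hmem : ∀ n, h c - t ∈ J ⊔ m ^ (n + 1) := fun n =>
    (f n).2 c (h c) t (IsAdicComplete.StrictMono.mk_liftRingHom m ha (fun n => (f n).1)
      (fun {n} => hF n (f n)) c).symm ht.symm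
  rw [← ht]
  -- `J` is closed by Krull's intersection theorem, as `S / J` is Noetherian and local.
  refine (IsHausdorff.eq_iff_smodEq (I := m)).2 fun n => ?_
  rw [SModEq.sub_mem, ← map_sub, ← Submodule.restrictScalars_mem S]
  obtain ⟨j, hj, y, hy, hjy⟩ := Submodule.mem_sup.1 (hmem n)
  rw [← hjy, map_add, Ideal.Quotient.eq_zero_iff_mem.2 hj, zero_add]
  have h3 : Ideal.Quotient.mk J y = y • (1 : S ⧸ J) := by
    rw [Algebra.smul_def, mul_one]; rfl
  rw [h3]
  exact Submodule.smul_mem_smul (Ideal.pow_le_pow_right n.le_succ hy) trivial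

/-! ### Adically complete rings -/

section AdicCompleteness

variable {A : Type*} [CommRing A]

/-- Precompleteness of a ring, in terms of successive differences. -/
theorem isPrecomplete_iff_exists_sub_mem (I : Ideal A) :
    IsPrecomplete I A ↔ ∀ f : ℕ → A, (∀ n, f (n + 1) - f n ∈ I ^ n) →
      ∃ L, ∀ n, f n - L ∈ I ^ n := by
  have hI : ∀ n, (I ^ n • ⊤ : Submodule A A) = I ^ n := fun n => by
    rw [smul_eq_mul, Ideal.mul_top]
  constructor
  · intro h f hf
    obtain ⟨L, hL⟩ := h.prec' f (fun {m n} hmn => by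
      rw [hI]
      induction n, hmn using Nat.le_induction with
      | base => rfl
      | succ n hmn ih =>
        refine ih.trans (SModEq.sub_mem.2 ?_)
        rw [← neg_sub]
        exact neg_mem (Ideal.pow_le_pow_right hmn (hf n)))
    exact ⟨L, fun n => by simpa [hI, SModEq.sub_mem] using hL n⟩
  · refine fun h => ⟨fun f hf => ?_⟩
    obtain ⟨L, hL⟩ := h f fun n => by
      have := (hf n.le_succ).symm
      rwa [hI, SModEq.sub_mem] at this
    exact ⟨L, fun n => by rw [hI, SModEq.sub_mem]; exact hL n⟩

theorem IsPrecomplete.exists_sum_sub_mem {I : Ideal A} (h : IsPrecomplete I A) (a : ℕ → A)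
    (ha : ∀ n, a n ∈ I ^ n) : ∃ L, ∀ n, ∑ i ∈ Finset.range n, a i - L ∈ I ^ n :=
  (isPrecomplete_iff_exists_sub_mem I).1 h _ fun n => by
    rw [Finset.sum_range_succ, add_sub_cancel_left]; exact ha n

/-- An element of `(I ⊔ J) ^ (2 * n)` is a sum of elements of `I ^ n` and `J ^ n`, so a Cauchy series
for `I ⊔ J` splits, after passing to every other partial sum, into Cauchy series for `I` and `J`. -/
theorem IsPrecomplete.sup {I J : Ideal A} (hI : IsPrecomplete I A) (hJ : IsPrecomplete J A) :
    IsPrecomplete (I ⊔ J) A := by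
  refine (isPrecomplete_iff_exists_sub_mem _).2 fun f hf => ?_
  have hmono : ∀ {m n}, m ≤ n → f n - f m ∈ (I ⊔ J) ^ m := fun {m n} hmn => by
    induction n, hmn using Nat.le_induction with
    | base => simp
    | succ n hmn ih =>
      rw [← sub_add_sub_cancel _ (f n)]
      exact add_mem (Ideal.pow_le_pow_right hmn (hf n)) ih
  have hdec : ∀ n, ∃ a ∈ I ^ n, ∃ b ∈ J ^ n, a + b = f (2 * (n + 1)) - f (2 * n) := fun n =>
    Submodule.mem_sup.1 (Ideal.sup_pow_add_le_pow_sup_pow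
      (two_mul n ▸ hmono (by lia : 2 * n ≤ 2 * (n + 1))))
  choose a ha b hb hab using hdec
  obtain ⟨La, hLa⟩ := hI.exists_sum_sub_mem a ha
  obtain ⟨Lb, hLb⟩ := hJ.exists_sum_sub_mem b hb
  refine ⟨f 0 + La + Lb, fun n => ?_⟩
  have hsum : ∑ i ∈ Finset.range n, a i + ∑ i ∈ Finset.range n, b i = f (2 * n) - f 0 := by
    rw [← Finset.sum_add_distrib, Finset.sum_congr rfl fun i _ => hab i]
    exact Finset.sum_range_sub (fun i => f (2 * i)) n
  have key : f n - (f 0 + La + Lb) = -(f (2 * n) - f n) +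
      ((∑ i ∈ Finset.range n, a i - La) + (∑ i ∈ Finset.range n, b i - Lb)) := by
    linear_combination -hsum
  rw [key]
  exact add_mem (neg_mem (hmono (by lia))) (add_mem (Ideal.pow_right_mono le_sup_left n (hLa n))
    (Ideal.pow_right_mono le_sup_right n (hLb n)))

theorem isPrecomplete_span_range {ι : Type*} [Finite ι] (x : ι → A)
    (h : ∀ i, IsPrecomplete (Ideal.span {x i}) A) : IsPrecomplete (Ideal.span (Set.range x)) A := by
  classical
  have := Fintype.ofFinite ι
  suffices ∀ s : Finset ι, IsPrecomplete (Ideal.span (x '' s)) A by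
    simpa using this Finset.univ
  intro s
  induction s using Finset.induction_on with
  | empty =>
    rw [Finset.coe_empty, Set.image_empty, Ideal.span_empty]
    infer_instance
  | insert i s _ ih =>
    rw [Finset.coe_insert, Set.image_insert_eq, Ideal.span_insert]
    exact (h i).sup ih

theorem IsPrecomplete.map_of_surjective {B : Type*} [CommRing B] {I : Ideal A}
    (h : IsPrecomplete I A) {f : A →+* B} (hf : Function.Surjective f) :
    IsPrecomplete (I.map f) B := by
  refine (isPrecomplete_iff_exists_sub_mem _).2 fun b hb => ?_
  have hlift : ∀ n, ∃ a ∈ I ^ n, f a = b (n + 1) - b n := fun n => by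
    have := hb n
    rwa [← Ideal.map_pow, Ideal.mem_map_iff_of_surjective f hf] at this
  choose a ha hab using hlift
  obtain ⟨L, hL⟩ := h.exists_sum_sub_mem a ha
  refine ⟨b 0 + f L, fun n => ?_⟩
  have hsum : f (∑ i ∈ Finset.range n, a i) = b n - b 0 := by
    rw [map_sum, Finset.sum_congr rfl fun i _ => hab i, Finset.sum_range_sub]
  have key : b n - (b 0 + f L) = f (∑ i ∈ Finset.range n, a i - L) := by
    rw [map_sub, hsum]; ring
  rw [key, ← Ideal.map_pow]
  exact Ideal.mem_map_of_mem f (hL n)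

theorem IsLocalRing.maximalIdeal_map_of_surjective [IsLocalRing A] {B : Type*} [CommRing B]
    [IsLocalRing B] {f : A →+* B} (hf : Function.Surjective f) :
    (maximalIdeal A).map f = maximalIdeal B :=
  ((Ideal.map_eq_top_or_isMaximal_of_surjective f hf inferInstance).resolve_left fun h => by
    have := IsLocalHom.of_surjective f hf
    have hle : (maximalIdeal A).map f ≤ maximalIdeal B := Ideal.map_le_iff_le_comap.2
      fun x hx => (map_mem_nonunits_iff f x).2 hx
    exact (maximalIdeal.isMaximal B).ne_top (top_le_iff.1 (h ▸ hle))) |> eq_maximalIdeal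

theorem isAdicComplete_maximalIdeal_of_surjective [IsLocalRing A] [IsNoetherianRing A]
    [IsAdicComplete (maximalIdeal A) A] {B : Type*} [CommRing B] [IsLocalRing B] {f : A →+* B}
    (hf : Function.Surjective f) : IsAdicComplete (maximalIdeal B) B := by
  have := isNoetherianRing_of_surjective A B f hf
  have h : IsPrecomplete (maximalIdeal B) B := maximalIdeal_map_of_surjective hf ▸
    IsPrecomplete.map_of_surjective inferInstance hf
  exact { h with }

theorem IsHausdorff.eq_zero_of_forall_mem_pow {I : Ideal A} (h : IsHausdorff I A) {x : A}
    (hx : ∀ n, x ∈ I ^ n) : x = 0 :=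
  h.haus x fun n => by
    rw [SModEq.zero, smul_eq_mul, Ideal.mul_top]; exact hx n

/-- The preimage of a sequence `y` is given by the series `xₙ = ∑ fⁱ yₙ₊ᵢ`. -/
theorem isDerivedComplete_of_le {I J : Ideal A} [IsAdicComplete I A] (hJ : J ≤ I) :
    IsDerivedComplete J A := by
  intro f hf
  have hfI : f ∈ I := hJ hf
  have haus : IsHausdorff I A := inferInstance
  constructor
  · intro x y hxy
    have hstep : ∀ n, x n - y n = f * (x (n + 1) - y (n + 1)) := fun n => by
      have := congrFun hxy n
      simp only [smul_eq_mul] at this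
      linear_combination this
    have hmem : ∀ k n, x n - y n ∈ I ^ k := fun k => by
      induction k with
      | zero => simp
      | succ k ih => intro n; rw [hstep, pow_succ']; exact Ideal.mul_mem_mul hfI (ih _)
    exact funext fun n => sub_eq_zero.1 (haus.eq_zero_of_forall_mem_pow fun k => hmem k n)
  · intro y
    have hlim := fun n => IsPrecomplete.exists_sum_sub_mem (I := I) (A := A) inferInstance
      (fun k => f ^ k * y (n + k)) fun k => Ideal.mul_mem_right _ _ (Ideal.pow_mem_pow hfI k)
    choose L hL using hlim
    refine ⟨L, funext fun n => sub_eq_zero.1 (haus.eq_zero_of_forall_mem_pow fun k => ?_)⟩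
    have hs : ∑ i ∈ Finset.range (k + 1), f ^ i * y (n + i) =
        y n + f * ∑ i ∈ Finset.range k, f ^ i * y (n + 1 + i) := by
      rw [Finset.sum_range_succ', Finset.mul_sum, add_comm]
      congr 1
      · simp
      · refine Finset.sum_congr rfl fun i _ => ?_
        rw [pow_succ', mul_assoc, add_assoc n 1 i, add_comm 1 i]
    have key : L n - f • L (n + 1) - y n =
        -(∑ i ∈ Finset.range (k + 1), f ^ i * y (n + i) - L n) +
          f * (∑ i ∈ Finset.range k, f ^ i * y (n + 1 + i) - L (n + 1)) := by
      rw [hs, smul_eq_mul]; ring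
    rw [key]
    exact add_mem (neg_mem (Ideal.pow_le_pow_right k.le_succ (hL n (k + 1))))
      (Ideal.mul_mem_left _ _ (hL (n + 1) k))

end AdicCompleteness

/-! ### Power series over a complete local ring -/

namespace MvPowerSeries

variable {σ C : Type*} [CommRing C]

theorem sub_C_constantCoeff_mem_span_range_X [Finite σ] (f : MvPowerSeries σ C) :
    f - MvPowerSeries.C (constantCoeff f) ∈
      Ideal.span (Set.range (X : σ → MvPowerSeries σ C)) := by
  classical
  have := Fintype.ofFinite σ
  have hv : ∀ e : σ →₀ ℕ, e ≠ 0 → ∃ i, e i ≠ 0 := fun e he => by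
    by_contra! h; exact he (Finsupp.ext h)
  choose v hv using hv
  -- Each nonconstant monomial is assigned to one of the variables that divide it.
  let φ (i : σ) : MvPowerSeries σ C := fun e => if h : e = 0 then 0 else
    if v e h = i then coeff e f else 0
  have hφ : ∀ i e, coeff e (φ i) = if h : e = 0 then 0 else
    if v e h = i then coeff e f else 0 := fun i e => rfl
  have hsum : f - MvPowerSeries.C (constantCoeff f) = ∑ i, φ i := by
    ext e
    rw [map_sum]
    simp only [hφ, map_sub, coeff_C]
    by_cases h : e = 0
    · subst h; simp
    · simp [h]
  rw [hsum]
  refine sum_mem fun i _ => Ideal.mem_of_dvd _ ?_ (Ideal.subset_span ⟨i, rfl⟩)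
  refine X_dvd_iff.2 fun e he => ?_
  rw [hφ]
  split_ifs with h1 h2
  · rfl
  · exact absurd (h2 ▸ he) (hv e h1)
  · rfl

theorem isPrecomplete_span_X (i : σ) :
    IsPrecomplete (Ideal.span {(X i : MvPowerSeries σ C)}) (MvPowerSeries σ C) := by
  refine (isPrecomplete_iff_exists_sub_mem _).2 fun f hf => ?_
  simp only [Ideal.span_singleton_pow, Ideal.mem_span_singleton, X_pow_dvd_iff] at hf ⊢
  let L : MvPowerSeries σ C := fun e => coeff e (f (e i + 1))
  refine ⟨L, fun n e he => ?_⟩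
  have hconst : ∀ n, e i + 1 ≤ n → coeff e (f n) = coeff e (f (e i + 1)) := fun n hn => by
    induction n, hn using Nat.le_induction with
    | base => rfl
    | succ n hn ih => rw [← ih, ← sub_eq_zero, ← map_sub]; exact hf n e hn
  rw [map_sub, sub_eq_zero]
  exact hconst n he

theorem C_dvd_iff (a : C) (f : MvPowerSeries σ C) :
    MvPowerSeries.C a ∣ f ↔ ∀ e, a ∣ coeff e f := by
  refine ⟨?_, fun h => ?_⟩
  · rintro ⟨g, rfl⟩ e
    rw [coeff_C_mul]; exact dvd_mul_right _ _
  · choose g hg using h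
    let G : MvPowerSeries σ C := g
    exact ⟨G, by ext e; rw [coeff_C_mul, hg]; rfl⟩

theorem isPrecomplete_span_C {a : C} (h : IsPrecomplete (Ideal.span {a}) C) :
    IsPrecomplete (Ideal.span {(MvPowerSeries.C a : MvPowerSeries σ C)}) (MvPowerSeries σ C) := by
  rw [isPrecomplete_iff_exists_sub_mem] at h
  refine (isPrecomplete_iff_exists_sub_mem _).2 fun f hf => ?_
  simp only [Ideal.span_singleton_pow, Ideal.mem_span_singleton, ← map_pow, C_dvd_iff,
    map_sub] at hf h ⊢
  choose L hL using fun e => h (fun n => coeff e (f n)) fun n => hf n e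
  exact ⟨(L : MvPowerSeries σ C), fun n e => hL e n⟩

section IsLocalRing

variable [IsLocalRing C]

theorem mem_maximalIdeal_iff (f : MvPowerSeries σ C) :
    f ∈ maximalIdeal (MvPowerSeries σ C) ↔ constantCoeff f ∈ maximalIdeal C := by
  rw [mem_maximalIdeal, mem_maximalIdeal, mem_nonunits_iff, mem_nonunits_iff,
    isUnit_iff_constantCoeff]

theorem X_mem_maximalIdeal (i : σ) : X i ∈ maximalIdeal (MvPowerSeries σ C) := by
  rw [mem_maximalIdeal_iff, constantCoeff_X]; exact zero_mem _

theorem maximalIdeal_eq_span [Finite σ] {a : C} (ha : maximalIdeal C = Ideal.span {a}) :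
    maximalIdeal (MvPowerSeries σ C) =
      Ideal.span {MvPowerSeries.C a} ⊔ Ideal.span (Set.range X) := by
  refine le_antisymm (fun f hf => ?_) (sup_le ?_ ?_)
  · rw [mem_maximalIdeal_iff, ha, Ideal.mem_span_singleton] at hf
    rw [← add_sub_cancel (MvPowerSeries.C (constantCoeff f)) f]
    exact Submodule.add_mem_sup (Ideal.mem_span_singleton.2 (map_dvd _ hf))
      (sub_C_constantCoeff_mem_span_range_X f)
  · rw [Ideal.span_singleton_le_iff_mem, mem_maximalIdeal_iff, constantCoeff_C, ha]
    exact Ideal.mem_span_singleton_self a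
  · rw [Ideal.span_le]; rintro _ ⟨i, rfl⟩; exact X_mem_maximalIdeal i

theorem isAdicComplete_maximalIdeal [Finite σ] [IsNoetherianRing C]
    [IsAdicComplete (maximalIdeal C) C]
    {a : C} (ha : maximalIdeal C = Ideal.span {a}) :
    IsAdicComplete (maximalIdeal (MvPowerSeries σ C)) (MvPowerSeries σ C) := by
  have hC : IsPrecomplete (Ideal.span {a}) C := ha ▸ inferInstance
  have h := (isPrecomplete_span_C (σ := σ) hC).sup (isPrecomplete_span_range _ isPrecomplete_span_X)
  rw [← maximalIdeal_eq_span ha] at h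
  exact { h with }

end IsLocalRing

/-- Homomorphisms that agree on coefficients and variables agree modulo every power of `I`, by
induction: a power series without constant term is a combination of the variables. -/
theorem ringHom_ext_of_isHausdorff [Finite σ] {R : Type*} [CommRing R] {I : Ideal R}
    (hI : IsHausdorff I R)
    {f g : MvPowerSeries σ C →+* R} (hC : ∀ c, f (MvPowerSeries.C c) = g (MvPowerSeries.C c))
    (hX : ∀ i, f (X i) = g (X i)) (hXI : ∀ i, f (X i) ∈ I) : f = g := by
  have hmem : ∀ n a, f a - g a ∈ I ^ n := fun n => by
    induction n with
    | zero => simp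
    | succ n ih =>
      intro a
      have key : ∀ b ∈ Ideal.span (Set.range (X : σ → MvPowerSeries σ C)),
          f b - g b ∈ I ^ (n + 1) := fun b hb => by
        induction hb using Submodule.span_induction with
        | mem b hb => obtain ⟨i, rfl⟩ := hb; simp [hX]
        | zero => simp
        | add b c _ _ hb hc => rw [map_add, map_add, add_sub_add_comm]; exact add_mem hb hc
        | smul r b hb hb' =>
          have hbI : f b ∈ I := by
            have : Ideal.span (Set.range (X : σ → MvPowerSeries σ C)) ≤ I.comap f := by
              rw [Ideal.span_le]; rintro _ ⟨i, rfl⟩; exact hXI i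
            exact this hb
          have : f (r • b) - g (r • b) = f b * (f r - g r) + g r * (f b - g b) := by
            rw [smul_eq_mul, map_mul, map_mul]; ring
          rw [this]
          exact add_mem (by rw [pow_succ']; exact Ideal.mul_mem_mul hbI (ih r))
            (Ideal.mul_mem_left _ _ hb')
      have := key _ (sub_C_constantCoeff_mem_span_range_X a)
      rwa [map_sub, map_sub, hC, sub_sub_sub_cancel_right] at this
  exact RingHom.ext fun a => sub_eq_zero.1 (hI.eq_zero_of_forall_mem_pow fun n => hmem n a)

/-- Evaluation of power series at elements of an ideal `I` of an `I`-adically complete ring: the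
limit of the evaluations of the truncations in `R / I ^ n`. -/
theorem exists_ringHom_of_isAdicComplete [Finite σ] {R : Type*} [CommRing R] {I : Ideal R}
    [IsAdicComplete I R] (h : C →+* R) (x : σ → R) (hx : ∀ i, x i ∈ I) :
    ∃ f : MvPowerSeries σ C →+* R, (∀ c, f (MvPowerSeries.C c) = h c) ∧ ∀ i, f (X i) = x i := by
  let e : MvPolynomial σ C →+* R := MvPolynomial.eval₂Hom h x
  have he : ∀ n, MvPolynomial.idealOfVars σ C ^ n ≤ (I ^ n).comap e := fun n => by
    refine le_trans (Ideal.pow_right_mono ?_ n) (Ideal.le_comap_pow e n)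
    rw [MvPolynomial.idealOfVars, Ideal.span_le]
    rintro _ ⟨i, rfl⟩
    simpa [e] using hx i
  let f (n : ℕ) : MvPowerSeries σ C →+* R ⧸ I ^ n :=
    (Ideal.quotientMap (I ^ n) e (he n)).comp (truncTotalAlgHom σ C n).toRingHom
  have hf : ∀ n a, f n a = Ideal.Quotient.mk _ (e (truncTotal n a)) := fun n a => rfl
  have hcompat : ∀ {m n : ℕ} (hle : m ≤ n), (Ideal.Quotient.factorPow I hle).comp (f n) = f m :=
    fun {m n} hle => by
      ext a
      rw [RingHom.comp_apply, hf, hf]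
      refine Ideal.Quotient.eq.2 ?_
      rw [← map_sub]
      exact he m (truncTotal_sub_truncTotal_mem_pow_idealOfVars hle le_rfl a)
  have haus : IsHausdorff I R := inferInstance
  have hpoly : ∀ P : MvPolynomial σ C, IsAdicComplete.liftRingHom I f hcompat P = e P := fun P => by
    refine sub_eq_zero.1 (haus.eq_zero_of_forall_mem_pow fun n => ?_)
    rw [← Ideal.Quotient.eq, IsAdicComplete.mk_liftRingHom]
    exact congrArg (Ideal.quotientMap (I ^ n) e (he n)) ((truncTotalAlgHom σ C n).commutes P)
  refine ⟨IsAdicComplete.liftRingHom I f hcompat, fun c => ?_, fun i => ?_⟩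
  · have := hpoly (MvPolynomial.C c)
    rwa [MvPolynomial.coe_C, MvPolynomial.eval₂Hom_C] at this
  · have := hpoly (MvPolynomial.X i)
    rwa [MvPolynomial.coe_X, MvPolynomial.eval₂Hom_X'] at this

theorem ringKrullDim_add_le (C : Type*) [CommRing C] (d : ℕ) :
    ringKrullDim C + d ≤ ringKrullDim (MvPowerSeries (Fin d) C) := by
  induction d with
  | zero =>
    rw [ringKrullDim_eq_of_ringEquiv (isEmptyEquiv (σ := Fin 0) (R := C)).toRingEquiv]
    simp
  | succ d ih =>
    rw [ringKrullDim_eq_of_ringEquiv (finSuccEquiv C d).toRingEquiv, Nat.cast_succ, ← add_assoc]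
    exact (add_le_add_left ih 1).trans ringKrullDim_succ_le_ringKrullDim_powerseries

end MvPowerSeries

/-! ### Regular local rings -/

section Regular

/-- Modulo `y = ∑ aᵢ xᵢ` with `aⱼ` a unit, the generator `xⱼ` of the maximal ideal is redundant. -/
theorem maximalIdeal_quotient_eq_span_of_isUnit {R : Type*} [CommRing R] [IsLocalRing R] {d : ℕ}
    {x : Fin (d + 1) → R} (hx : Ideal.span (Set.range x) = maximalIdeal R) (a : Fin (d + 1) → R)
    (j : Fin (d + 1)) (ha : IsUnit (a j)) {y : R} (hy : ∑ i, a i * x i = y)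
    [IsLocalRing (R ⧸ Ideal.span {y})] :
    Ideal.span (Set.range fun i => Ideal.Quotient.mk (Ideal.span {y}) (x (j.succAbove i))) =
      maximalIdeal (R ⧸ Ideal.span {y}) := by
  rw [← maximalIdeal_map_of_surjective (Ideal.Quotient.mk_surjective (I := Ideal.span {y})), ← hx,
    Ideal.map_span]
  refine le_antisymm (Ideal.span_mono ?_) (Ideal.span_le.2 ?_)
  · rintro _ ⟨i, rfl⟩; exact ⟨_, ⟨_, rfl⟩, rfl⟩
  · rintro _ ⟨_, ⟨i, rfl⟩, rfl⟩
    have hother : ∀ i, Ideal.Quotient.mk (Ideal.span {y}) (x (j.succAbove i)) ∈ Ideal.span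
        (Set.range fun i => Ideal.Quotient.mk (Ideal.span {y}) (x (j.succAbove i))) :=
      fun i => Ideal.subset_span ⟨i, rfl⟩
    obtain rfl | ⟨i, rfl⟩ := Fin.eq_self_or_eq_succAbove j i
    · have h0 : Ideal.Quotient.mk (Ideal.span {y}) (∑ l, a l * x l) = 0 := by
        rw [hy, Ideal.Quotient.eq_zero_iff_mem]; exact Ideal.mem_span_singleton_self y
      rw [Fin.sum_univ_succAbove _ i, map_add, map_mul, map_sum] at h0
      refine (Ideal.unit_mul_mem_iff_mem _ (ha.map (Ideal.Quotient.mk (Ideal.span {y})))).1 ?_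
      rw [eq_neg_of_add_eq_zero_left h0]
      refine neg_mem (sum_mem fun l _ => ?_)
      rw [map_mul]
      exact Ideal.mul_mem_left _ _ (hother l)
    · exact hother i

theorem le_ringKrullDim_quotient_span_singleton {R : Type*} [CommRing R] [IsLocalRing R]
    [IsNoetherianRing R] {y : R} (hy : y ∈ maximalIdeal R) {d : ℕ}
    (hd : ((d + 1 : ℕ) : WithBot ℕ∞) ≤ ringKrullDim R) :
    (d : WithBot ℕ∞) ≤ ringKrullDim (R ⧸ Ideal.span {y}) := by
  have h := ringKrullDim_le_ringKrullDim_quotient_add_card (R := R) {y} (by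
    simpa [ringJacobson_eq_maximalIdeal] using hy)
  rw [Finset.coe_singleton, Finset.card_singleton, Nat.cast_one] at h
  have h2 := hd.trans h
  rw [Nat.cast_succ] at h2
  exact ENat.WithBot.add_le_add_one_right_iff.1 h2

/-- A regular local ring is a domain. By induction on the dimension: prime avoidance gives an element
`y` of the maximal ideal, outside its square and outside all minimal primes. The quotient by `y` is
regular of smaller dimension, so `(y)` is prime. A minimal prime `P ⊆ (y)` satisfies `P = yP`, hence
`P = 0`. -/
theorem isDomain_of_span_range_eq_maximalIdeal {d : ℕ} :
    ∀ (R : Type u) [CommRing R] [IsLocalRing R] [IsNoetherianRing R] (x : Fin d → R),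
      Ideal.span (Set.range x) = maximalIdeal R → (d : WithBot ℕ∞) ≤ ringKrullDim R →
      IsDomain R := by
  induction d with
  | zero =>
    intro R _ _ _ x hx _
    rw [Set.range_eq_empty, Ideal.span_empty] at hx
    exact (isField_iff_maximalIdeal_eq.2 hx.symm).isDomain
  | succ d ih =>
    intro R _ _ _ x hx hd
    have hmin : ∀ P ∈ minimalPrimes R, ¬ maximalIdeal R ≤ P := fun P hP hle => by
      have hPm : P = maximalIdeal R := ((maximalIdeal.isMaximal R).eq_of_le hP.1.1.ne_top hle).symm
      have := hP.1.1
      rw [← maximalIdeal_height_eq_ringKrullDim, ← hPm, Ideal.height_eq_zero_iff.2 hP] at hd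
      norm_cast at hd
    have hexists : ∃ y ∈ maximalIdeal R, y ∉ maximalIdeal R ^ 2 ∧ ∀ P ∈ minimalPrimes R, y ∉ P := by
      by_contra! hcon
      have hfin : (minimalPrimes R).Finite := minimalPrimes.finite_of_isNoetherianRing R
      -- Prime avoidance allows two of the ideals not to be prime; both are taken to be the square.
      have h := (Ideal.subset_union_prime' (s := hfin.toFinset) (f := fun i : Ideal R => i)
        (a := maximalIdeal R ^ 2) (b := maximalIdeal R ^ 2) (I := maximalIdeal R)
        (fun P hP => ((hfin.mem_toFinset).1 hP).1.1)).1 (fun y hy => by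
          by_cases hy2 : y ∈ maximalIdeal R ^ 2
          · exact Or.inl (Or.inl hy2)
          · obtain ⟨P, hP, hyP⟩ := hcon y hy hy2
            exact Or.inr (Set.mem_iUnion₂.2 ⟨P, hfin.mem_toFinset.2 hP, hyP⟩))
      have hsq : ¬ maximalIdeal R ≤ maximalIdeal R ^ 2 := fun hle => by
        obtain ⟨P, hP⟩ := Ideal.nonempty_minimalPrimes (bot_ne_top (α := Ideal R))
        have : maximalIdeal R = ⊥ := Submodule.eq_bot_of_le_smul_of_le_jacobson_bot
          (maximalIdeal R) _ (IsNoetherian.noetherian _) (by rwa [pow_two] at hle)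
          (jacobson_eq_maximalIdeal ⊥ bot_ne_top).ge
        exact hmin P hP (this ▸ bot_le)
      obtain h | h | ⟨P, hP, h⟩ := h
      · exact hsq h
      · exact hsq h
      · exact hmin P (hfin.mem_toFinset.1 hP) h
    obtain ⟨y, hy, hy2, hyP⟩ := hexists
    obtain ⟨a, ha⟩ := Ideal.mem_span_range_iff_exists_fun.1 (hx.symm ▸ hy)
    have hunit : ∃ j, IsUnit (a j) := by
      by_contra! hcon
      refine hy2 (ha ▸ sum_mem fun i _ => ?_)
      rw [pow_two]
      exact Ideal.mul_mem_mul (hcon i) (hx ▸ Ideal.subset_span ⟨i, rfl⟩)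
    obtain ⟨j, hj⟩ := hunit
    have hne : Ideal.span {y} ≠ ⊤ := fun h =>
      (mem_maximalIdeal y).1 hy (Ideal.span_singleton_eq_top.1 h)
    have := Ideal.Quotient.nontrivial_iff.2 hne
    have : IsLocalRing (R ⧸ Ideal.span {y}) :=
      IsLocalRing.of_surjective' _ Ideal.Quotient.mk_surjective
    have hdom : IsDomain (R ⧸ Ideal.span {y}) := ih _ _
      (maximalIdeal_quotient_eq_span_of_isUnit hx a j hj ha)
      (le_ringKrullDim_quotient_span_singleton hy hd)
    have hprime : (Ideal.span {y}).IsPrime := (Ideal.Quotient.isDomain_iff_prime _).1 hdom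
    obtain ⟨P, hP, hPy⟩ := Ideal.exists_minimalPrimes_le (bot_le : ⊥ ≤ Ideal.span {y})
    have hPprime : P.IsPrime := hP.1.1
    have hPbot : P = ⊥ := Submodule.eq_bot_of_le_smul_of_le_jacobson_bot
      (maximalIdeal R) _ (IsNoetherian.noetherian _) (fun z hz => by
        obtain ⟨w, rfl⟩ := Ideal.mem_span_singleton.1 (hPy hz)
        exact Ideal.mul_mem_mul hy ((hPprime.mem_or_mem hz).resolve_left (hyP P hP)))
      (jacobson_eq_maximalIdeal ⊥ bot_ne_top).ge
    rw [hPbot] at hPprime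
    exact IsDomain.of_bot_isPrime R

theorem IsRegularLocalRing.exists_span_range_eq_maximalIdeal {R : Type*} [CommRing R]
    [IsRegularLocalRing R] {d : ℕ} (hd : ringKrullDim R = d) :
    ∃ x : Fin d → R, Ideal.span (Set.range x) = maximalIdeal R := by
  have hfg : (maximalIdeal R).FG := IsNoetherian.noetherian _
  have hcard : (maximalIdeal R).generators.ncard = d := by
    rw [Submodule.FG.generators_ncard hfg]
    have := (IsRegularLocalRing.spanFinrank_maximalIdeal (R := R)).trans hd
    exact_mod_cast this
  have hfin := Submodule.FG.finite_generators hfg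
  have hcard' : hfin.toFinset.card = d := by rw [← hcard, Set.ncard_eq_toFinset_card _ hfin]
  let e := hfin.toFinset.equivFinOfCardEq hcard'
  refine ⟨fun i => e.symm i, ?_⟩
  have : Set.range (fun i => (e.symm i : R)) = (maximalIdeal R).generators := by
    ext z
    constructor
    · rintro ⟨i, rfl⟩; exact hfin.mem_toFinset.1 (e.symm i).2
    · exact fun hz => ⟨e ⟨z, hfin.mem_toFinset.2 hz⟩, by simp⟩
  rw [this]
  exact (maximalIdeal R).span_generators

theorem spanFinrank_maximalIdeal_le {R : Type*} [CommRing R] [IsLocalRing R] {d : ℕ}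
    {x : Fin d → R} (hx : Ideal.span (Set.range x) = maximalIdeal R) :
    (maximalIdeal R).spanFinrank ≤ d := by
  rw [← hx, ← Set.image_univ]
  refine (Submodule.spanFinrank_span_le_ncard_of_finite (Set.toFinite _)).trans ?_
  exact (Set.ncard_image_le Set.finite_univ).trans (by simp)

end Regular

/-! ### Prism ideals and distinguished power series -/

/-- In a cover of the spectrum of a local ring by basic opens `D(f)`, some `f` is a unit, so
localizing at it changes nothing. -/
theorem IsLocallyFreeOfRankOne.exists_eq_span_singleton {A : Type*} [CommRing A] [IsLocalRing A]
    {I : Ideal A} (h : IsLocallyFreeOfRankOne A I) : ∃ ξ, I = Ideal.span {ξ} := by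
  obtain ⟨s, hs, hfree⟩ := h
  have hf : ∃ f ∈ s, IsUnit f := by
    by_contra! hcon
    exact (maximalIdeal.isMaximal A).ne_top
      (top_le_iff.1 (hs ▸ Ideal.span_le.2 fun f hf => hcon f hf))
  obtain ⟨f, hfs, hfu⟩ := hf
  have hunit : ∀ t : Submonoid.powers f, IsUnit (t : A) := by
    rintro ⟨_, n, rfl⟩; exact hfu.pow n
  obtain ⟨e⟩ := hfree f hfs
  obtain ⟨⟨x, t⟩, hxt⟩ : ∃ y : I × Submonoid.powers f, LocalizedModule.mk y.1 y.2 = e.symm 1 := by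
    induction e.symm 1 using LocalizedModule.induction_on with
    | h m s => exact ⟨(m, s), rfl⟩
  refine ⟨x, le_antisymm (fun y hy => ?_) (Ideal.span_le.2 (by simp))⟩
  obtain ⟨⟨a, b⟩, hab⟩ := IsLocalization.mk'_surjective (Submonoid.powers f)
    (e (LocalizedModule.mk ⟨y, hy⟩ 1))
  have h1 : LocalizedModule.mk ⟨y, hy⟩ 1 = Localization.mk a b • LocalizedModule.mk x t := by
    apply e.injective
    rw [hxt, map_smul, e.apply_symm_apply, smul_eq_mul, mul_one, Localization.mk_eq_mk']
    exact hab.symm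
  rw [LocalizedModule.mk_smul_mk, LocalizedModule.mk_eq] at h1
  obtain ⟨c, hc⟩ := h1
  have h2 : (c : A) * (((b * t : Submonoid.powers f) : A) * y) = c * (a * x) := by
    simpa [Submonoid.smul_def] using congrArg (Subtype.val : I → A) hc
  rw [(hunit c).mul_right_inj] at h2
  rw [← Ideal.unit_mul_mem_iff_mem _ (hunit (b * t)), h2]
  exact Ideal.mul_mem_left _ _ (Ideal.mem_span_singleton_self _)

theorem isLocallyFreeOfRankOne_span_singleton {A : Type*} [CommRing A] [IsDomain A] {ξ : A}
    (hξ : ξ ≠ 0) : IsLocallyFreeOfRankOne A (Ideal.span {ξ}) := by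
  refine ⟨{1}, Ideal.span_singleton_one, fun f _ => ?_⟩
  let S := Submonoid.powers f
  let e : Ideal.span {ξ} ≃ₗ[A] A := (LinearEquiv.toSpanNonzeroSingleton A A ξ hξ).symm
  let g : Ideal.span {ξ} →ₗ[A] Localization S :=
    (Algebra.linearMap A (Localization S)).comp e.toLinearMap
  have : IsLocalizedModule S g := IsLocalizedModule.of_linearEquiv_right S _ e
  exact ⟨(IsLocalizedModule.iso S g).extendScalarsOfIsLocalization S (Localization S)⟩

/-- A power series is distinguished if its constant coefficient is `p` times a unit. -/
def IsDistinguished (p : ℕ) {σ C : Type*} [CommRing C] (ξ : MvPowerSeries σ C) : Prop :=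
  ∃ u, IsUnit u ∧ MvPowerSeries.constantCoeff ξ = p * u

section Prism

open MvPowerSeries

variable {p : ℕ} {C : Type*} [CommRing C]

theorem DeltaStructure.constantCoeff_mvPowerSeries_φ (hp : p.Prime)
    (hA : (p : C) ∈ nonZeroDivisors C) (D : DeltaStructure p C) (σ : Type*) [Finite σ]
    (f : MvPowerSeries σ C) :
    constantCoeff ((D.mvPowerSeries hp hA σ).φ f) = D.φ (constantCoeff f) := by
  rw [DeltaStructure.mvPowerSeries, DeltaStructure.φ_ofFrobeniusLift]
  change constantCoeff (MvPowerSeries.expand p hp.ne_zero (MvPowerSeries.map _ f)) = _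
  rw [constantCoeff_expand, constantCoeff_map]
  rfl

variable [IsDomain C] [IsDiscreteValuationRing C]

theorem IsPrism.exists_isDistinguished (hp : p.Prime)
    (hm : maximalIdeal C = Ideal.span {(p : C)}) (hA : (p : C) ∈ nonZeroDivisors C)
    (D : DeltaStructure p C) {σ : Type*} [Finite σ] {I : Ideal (MvPowerSeries σ C)}
    (hI : IsPrism (D.mvPowerSeries hp hA σ) I) :
    ∃ ξ, I = Ideal.span {ξ} ∧ IsDistinguished p ξ := by
  obtain ⟨ξ, rfl⟩ := hI.locallyFree.exists_eq_span_singleton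
  refine ⟨ξ, rfl, ?_⟩
  have hp0 : (p : C) ≠ 0 := nonZeroDivisors.ne_zero hA
  have hξ : ξ ∈ maximalIdeal (MvPowerSeries σ C) := by
    intro hu
    have htop : Ideal.span {(p : MvPowerSeries σ C)} ⊔ Ideal.span {ξ} = ⊤ := by
      rw [Ideal.span_singleton_eq_top.2 hu, sup_top_eq]
    -- For the unit ideal, `f = 1` would be allowed, and constant sequences are in the kernel.
    have h := (hI.derivedComplete 1 (htop ▸ Submodule.mem_top)).1
      (a₁ := fun _ => 1) (a₂ := fun _ => 0) (by simp)
    exact one_ne_zero (congrFun h 0)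
  rw [mem_maximalIdeal_iff, hm, Ideal.mem_span_singleton] at hξ
  obtain ⟨u, hu⟩ := hξ
  refine ⟨u, ?_, hu⟩
  -- If `u` is not a unit, `p ^ 2` divides the constant coefficients of all elements of `I + φ(I)A`.
  by_contra hnu
  have hu' : u ∈ maximalIdeal C := hnu
  rw [hm, Ideal.mem_span_singleton] at hu'
  obtain ⟨w, rfl⟩ := hu'
  have hle : Ideal.span {ξ} ⊔ Ideal.span ((D.mvPowerSeries hp hA σ).φ '' Ideal.span {ξ}) ≤
      (Ideal.span {(p : C) ^ 2}).comap constantCoeff := by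
    have h1 : Ideal.span {ξ} ≤ (Ideal.span {(p : C) ^ 2}).comap constantCoeff := by
      rw [Ideal.span_singleton_le_iff_mem, Ideal.mem_comap, hu, Ideal.mem_span_singleton]
      exact ⟨w, by ring⟩
    refine sup_le h1 (Ideal.span_le.2 ?_)
    rintro _ ⟨x, hx, rfl⟩
    have hx' := h1 hx
    rw [Ideal.mem_comap, Ideal.mem_span_singleton] at hx'
    obtain ⟨y, hy⟩ := hx'
    rw [SetLike.mem_coe, Ideal.mem_comap, D.constantCoeff_mvPowerSeries_φ, hy,
      Ideal.mem_span_singleton]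
    change _ ∣ D.frobeniusLift hp _
    rw [map_mul, map_pow, map_natCast]
    exact dvd_mul_right _ _
  have hmem := hle hI.mem
  rw [Ideal.mem_comap, map_natCast, Ideal.mem_span_singleton] at hmem
  obtain ⟨y, hy⟩ := hmem
  have hpu : IsUnit (p : C) := IsUnit.of_mul_eq_one y (mul_left_cancel₀ hp0 (by
    rw [mul_one, ← mul_assoc, ← pow_two, ← hy]))
  have hpm : (p : C) ∈ maximalIdeal C := hm ▸ Ideal.mem_span_singleton_self _
  exact hpm hpu

theorem IsDistinguished.mem_maximalIdeal {σ : Type*} (hm : maximalIdeal C = Ideal.span {(p : C)})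
    {ξ : MvPowerSeries σ C} (hξ : IsDistinguished p ξ) :
    ξ ∈ maximalIdeal (MvPowerSeries σ C) := by
  obtain ⟨u, -, hu⟩ := hξ
  rw [mem_maximalIdeal_iff, hm, hu]
  exact Ideal.mul_mem_right _ _ (Ideal.mem_span_singleton_self _)

theorem IsDistinguished.isPrism (hp : p.Prime) [IsAdicComplete (maximalIdeal C) C]
    (hm : maximalIdeal C = Ideal.span {(p : C)}) (hA : (p : C) ∈ nonZeroDivisors C)
    (D : DeltaStructure p C) {σ : Type*} [Finite σ] {ξ : MvPowerSeries σ C}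
    (hξ : IsDistinguished p ξ) : IsPrism (D.mvPowerSeries hp hA σ) (Ideal.span {ξ}) := by
  have hp0 : (p : C) ≠ 0 := nonZeroDivisors.ne_zero hA
  have hpm : (p : C) ∈ maximalIdeal C := hm ▸ Ideal.mem_span_singleton_self _
  have hξm := hξ.mem_maximalIdeal hm
  obtain ⟨u, hu, hξu⟩ := hξ
  have : IsDomain (MvPowerSeries σ C) := NoZeroDivisors.to_isDomain _
  refine ⟨isLocallyFreeOfRankOne_span_singleton ?_, ?_, ?_⟩
  · rintro rfl
    rw [map_zero] at hξu
    exact mul_ne_zero hp0 hu.ne_zero hξu.symm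
  · have := isAdicComplete_maximalIdeal (σ := σ) hm
    refine isDerivedComplete_of_le (I := maximalIdeal (MvPowerSeries σ C)) (sup_le ?_ ?_)
    · rw [Ideal.span_singleton_le_iff_mem, mem_maximalIdeal_iff, map_natCast]
      exact hpm
    · rwa [Ideal.span_singleton_le_iff_mem]
  · set D' := D.mvPowerSeries hp hA σ
    have hφ : D'.φ ξ = ξ ^ p + p * D'.δ ξ := rfl
    have hunit : IsUnit (D'.δ ξ) := by
      rw [isUnit_iff_constantCoeff]
      have h := congrArg constantCoeff hφ
      rw [D.constantCoeff_mvPowerSeries_φ, map_add, map_mul, map_pow, map_natCast, hξu] at h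
      -- In constant coefficients, `p δ(ξ) = φ(p u) - (p u) ^ p`; division by `p` leaves a unit.
      have h2 : D.φ (p * u) = p * D.φ u := by
        change D.frobeniusLift hp _ = p * D.frobeniusLift hp _
        rw [map_mul, map_natCast]
      obtain ⟨n, hn⟩ := Nat.exists_eq_add_of_le' hp.two_le
      have h3 : constantCoeff (D'.δ ξ) = D.frobeniusLift hp u - p * ((p * u) ^ n * u * u) := by
        apply mul_left_cancel₀ hp0
        change _ = (p : C) * (D.φ u - _)
        have hpow : (p * u : C) ^ p = p * (p * ((p * u) ^ n * u * u)) :=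
          (congrArg ((p * u : C) ^ ·) hn).trans (by ring)
        rw [mul_sub, ← h2, h, hpow]
        ring
      rw [h3]
      by_contra hnu
      have h4 := add_mem ((IsLocalRing.mem_maximalIdeal _).2 hnu)
        (Ideal.mul_mem_right ((p * u) ^ n * u * u) _ hpm)
      rw [sub_add_cancel] at h4
      exact h4 (hu.map _)
    rw [← Ideal.mul_unit_mem_iff_mem _ hunit, ← sub_eq_of_eq_add' hφ]
    refine sub_mem (Ideal.mem_sup_right (Ideal.subset_span ⟨ξ, ?_, rfl⟩)) (Ideal.mem_sup_left ?_)
    · exact Ideal.mem_span_singleton_self ξ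
    · exact Ideal.pow_mem_of_mem _ (Ideal.mem_span_singleton_self ξ) _ hp.pos

theorem isLocalRing_quotient_of_le_maximalIdeal {A : Type*} [CommRing A] [IsLocalRing A]
    {I : Ideal A} (hI : I ≤ maximalIdeal A) : IsLocalRing (A ⧸ I) := by
  have := Ideal.Quotient.nontrivial_iff.2
    (fun h => (maximalIdeal.isMaximal A).ne_top (top_le_iff.1 (h ▸ hI)) : I ≠ ⊤)
  exact IsLocalRing.of_surjective' _ Ideal.Quotient.mk_surjective

theorem IsDistinguished.maximalIdeal_quotient_eq_span {d : ℕ}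
    (hm : maximalIdeal C = Ideal.span {(p : C)}) {ξ : MvPowerSeries (Fin d) C}
    (hξ : IsDistinguished p ξ) [IsLocalRing (MvPowerSeries (Fin d) C ⧸ Ideal.span {ξ})] :
    Ideal.span (Set.range fun i => Ideal.Quotient.mk (Ideal.span {ξ}) (X i)) =
      maximalIdeal (MvPowerSeries (Fin d) C ⧸ Ideal.span {ξ}) := by
  obtain ⟨u, hu, hξu⟩ := hξ
  obtain ⟨b, hb⟩ := Ideal.mem_span_range_iff_exists_fun.1 (sub_C_constantCoeff_mem_span_range_X ξ)
  let x : Fin (d + 1) → MvPowerSeries (Fin d) C := Fin.cons (MvPowerSeries.C (p : C)) X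
  let a : Fin (d + 1) → MvPowerSeries (Fin d) C := Fin.cons (MvPowerSeries.C u) b
  have hx : Ideal.span (Set.range x) = maximalIdeal (MvPowerSeries (Fin d) C) := by
    rw [maximalIdeal_eq_span hm, Fin.range_cons, Ideal.span_insert]
  have hax : ∑ i, a i * x i = ξ := by
    rw [Fin.sum_univ_succ]
    simp only [a, x, Fin.cons_zero, Fin.cons_succ, hb, ← map_mul, mul_comm u, ← hξu,
      add_sub_cancel]
  simpa [x] using maximalIdeal_quotient_eq_span_of_isUnit hx a 0 (hu.map _) hax

theorem IsDistinguished.le_ringKrullDim_quotient {d : ℕ}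
    (hm : maximalIdeal C = Ideal.span {(p : C)}) {ξ : MvPowerSeries (Fin d) C}
    (hξ : IsDistinguished p ξ) :
    (d : WithBot ℕ∞) ≤ ringKrullDim (MvPowerSeries (Fin d) C ⧸ Ideal.span {ξ}) := by
  refine le_ringKrullDim_quotient_span_singleton (hξ.mem_maximalIdeal hm) ?_
  have h := MvPowerSeries.ringKrullDim_add_le C d
  rw [IsPrincipalIdealRing.ringKrullDim_eq_one C (IsDiscreteValuationRing.not_isField C)] at h
  rwa [Nat.cast_succ, add_comm]

theorem residueField_equiv_of_surjective {B k : Type*} [CommRing B] [IsLocalRing B] [Field k]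
    {f : B →+* k} (hf : Function.Surjective f) : Nonempty (ResidueField B ≃+* k) := by
  have hker : maximalIdeal B = RingHom.ker f :=
    (eq_maximalIdeal (RingHom.ker_isMaximal_of_surjective f hf)).symm
  exact ⟨(Ideal.quotEquivOfEq hker).trans (RingHom.quotientKerEquivOfSurjective hf)⟩

theorem IsDistinguished.isCompleteRegularLocalRing_quotient {k : Type*} [Field k] {d : ℕ}
    (hC : IsCohenRing p k C) {ξ : MvPowerSeries (Fin d) C} (hξ : IsDistinguished p ξ) :
    IsCompleteRegularLocalRing k d (MvPowerSeries (Fin d) C ⧸ Ideal.span {ξ}) := by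
  have hm := hC.maximalIdeal_eq
  have := hC.isAdicComplete
  have := isAdicComplete_maximalIdeal (σ := Fin d) hm
  have hle : Ideal.span {ξ} ≤ maximalIdeal (MvPowerSeries (Fin d) C) := by
    rw [Ideal.span_singleton_le_iff_mem]; exact hξ.mem_maximalIdeal hm
  have := isLocalRing_quotient_of_le_maximalIdeal hle
  have hspan := spanFinrank_maximalIdeal_le (hξ.maximalIdeal_quotient_eq_span hm)
  have hdim := hξ.le_ringKrullDim_quotient hm
  obtain ⟨e⟩ := hC.residue
  let τ : MvPowerSeries (Fin d) C →+* k :=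
    (e : _ →+* k).comp ((Ideal.Quotient.mk (Ideal.span {(p : C)})).comp constantCoeff)
  have hτ : Function.Surjective τ := fun x => by
    obtain ⟨c, hc⟩ := Ideal.Quotient.mk_surjective (e.symm x)
    exact ⟨MvPowerSeries.C c, by simp [τ, hc]⟩
  have hτker : Ideal.span {ξ} ≤ RingHom.ker τ := by
    obtain ⟨u, -, hu⟩ := hξ
    rw [Ideal.span_singleton_le_iff_mem, RingHom.mem_ker]
    have : Ideal.Quotient.mk (Ideal.span {(p : C)}) (p * u) = 0 :=
      Ideal.Quotient.eq_zero_iff_mem.2 (Ideal.mul_mem_right _ _ (Ideal.mem_span_singleton_self _))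
    change e (Ideal.Quotient.mk _ (constantCoeff ξ)) = 0
    rw [hu, this, map_zero]
  refine ⟨?_, ?_, ?_, ?_⟩
  · exact .of_spanFinrank_maximalIdeal_le _ (le_trans (by exact_mod_cast hspan) hdim)
  · exact isAdicComplete_maximalIdeal_of_surjective Ideal.Quotient.mk_surjective
  · refine le_antisymm ((ringKrullDim_le_spanFinrank_maximalIdeal _).trans ?_) hdim
    exact_mod_cast hspan
  · exact residueField_equiv_of_surjective
      (Ideal.Quotient.lift_surjective_of_surjective _ hτker hτ)

end Prism

/-! ### Presentations of complete regular local rings -/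

section Classification

open MvPowerSeries

variable {p : ℕ} {C : Type u} [CommRing C] {k : Type v} [Field k]

/-- The Cohen structure theorem for regular local rings: each is the quotient of a power series ring
over the Cohen ring by a distinguished element. -/
theorem exists_isDistinguished_quotient_equiv [CharP k p] (hp : p.Prime) (hC : IsCohenRing p k C)
    {d : ℕ} {R : Type u} [CommRing R] (hR : IsCompleteRegularLocalRing k d R) :
    ∃ ξ : MvPowerSeries (Fin d) C, IsDistinguished p ξ ∧
      Nonempty ((MvPowerSeries (Fin d) C ⧸ Ideal.span {ξ}) ≃+* R) := by
  have : Fact p.Prime := ⟨hp⟩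
  have := hC.isDomain
  have := hC.isDiscreteValuationRing
  have := hC.isAdicComplete
  have hm := hC.maximalIdeal_eq
  have := isAdicComplete_maximalIdeal (σ := Fin d) hm
  have := hR.isRegularLocalRing
  have hRc := hR.isAdicComplete
  obtain ⟨eC⟩ := hC.residue
  obtain ⟨eR⟩ := hR.residue
  obtain ⟨x, hx⟩ := IsRegularLocalRing.exists_span_range_eq_maximalIdeal hR.ringKrullDim_eq
  have hxm : ∀ i, x i ∈ maximalIdeal R := fun i => hx ▸ Ideal.subset_span ⟨i, rfl⟩
  have hpR : (p : R) ∈ maximalIdeal R := by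
    rw [← residue_eq_zero_iff]
    apply eR.injective
    rw [map_natCast, map_natCast, map_zero, CharP.cast_eq_zero]
  let g : C →+* R ⧸ maximalIdeal R :=
    (eR.symm : k →+* ResidueField R).comp
      ((eC : C ⧸ Ideal.span {(p : C)} →+* k).comp (Ideal.Quotient.mk _))
  have hg : Function.Surjective g :=
    eR.symm.surjective.comp (eC.surjective.comp Ideal.Quotient.mk_surjective)
  obtain ⟨h, hh⟩ := exists_lift_of_isAdicComplete hC.natCast_mem_nonZeroDivisors
    (hm ▸ maximalIdeal.isMaximal C) hpR le_rfl g
  obtain ⟨f, hfC, hfX⟩ := exists_ringHom_of_isAdicComplete (I := maximalIdeal R) h x hxm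
  -- The images of the variables generate the maximal ideal of `R`, which contains `p`.
  have hfm : (maximalIdeal (MvPowerSeries (Fin d) C)).map f = maximalIdeal R := by
    rw [maximalIdeal_eq_span hm, Ideal.map_sup, Ideal.map_span, Ideal.map_span, ← Set.range_comp,
      (funext hfX : f ∘ X = x), hx, Set.image_singleton, hfC, map_natCast]
    exact sup_eq_right.2 ((Ideal.span_singleton_le_iff_mem _).2 hpR)
  have hf : Function.Surjective f := by
    have : IsHausdorff ((maximalIdeal (MvPowerSeries (Fin d) C)).map f) R := hfm ▸ inferInstance
    refine surjective_of_mk_map_comp_surjective (I := maximalIdeal (MvPowerSeries (Fin d) C)) f ?_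
    intro y
    obtain ⟨r, rfl⟩ := Ideal.Quotient.mk_surjective y
    obtain ⟨c, hc⟩ := hg (Ideal.Quotient.mk _ r)
    refine ⟨MvPowerSeries.C c, ?_⟩
    rw [RingHom.comp_apply, hfC, Ideal.Quotient.eq, hfm, ← Ideal.Quotient.eq, hh, hc]
  obtain ⟨r, hr⟩ := Ideal.mem_span_range_iff_exists_fun.1 (hx.symm ▸ hpR)
  choose a ha using fun i => hf (r i)
  let ξ : MvPowerSeries (Fin d) C := p - ∑ i, a i * X i
  have hξ : IsDistinguished p ξ := ⟨1, isUnit_one, by simp [ξ]⟩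
  have hfξ : f ξ = 0 := by simp [ξ, ha, hfX, hr]
  have hle : Ideal.span {ξ} ≤ RingHom.ker f := (Ideal.span_singleton_le_iff_mem _).2 hfξ
  have hB := hξ.isCompleteRegularLocalRing_quotient hC
  have := hB.isRegularLocalRing
  have := isDomain_of_span_range_eq_maximalIdeal _ _ (hξ.maximalIdeal_quotient_eq_span hm)
    hB.ringKrullDim_eq.ge
  let f' : MvPowerSeries (Fin d) C ⧸ Ideal.span {ξ} →+* R := Ideal.Quotient.lift _ f hle
  have hf' : Function.Surjective f' := Ideal.Quotient.lift_surjective_of_surjective _ hle hf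
  refine ⟨ξ, hξ, ⟨RingEquiv.ofBijective f' ⟨(injective_iff_map_eq_zero f').2 fun b hb => ?_, hf'⟩⟩⟩
  by_contra hb0
  -- Both rings have dimension `d`, and `A / ξ` is a domain.
  have hdim := ringKrullDim_succ_le_of_surjective f' hf' (mem_nonZeroDivisors_of_ne_zero hb0) hb
  rw [hR.ringKrullDim_eq, hB.ringKrullDim_eq] at hdim
  norm_cast at hdim
  lia

theorem IsDistinguished.notMem_maximalIdeal_sq [IsDomain C] [IsDiscreteValuationRing C]
    {σ : Type*} (hm : maximalIdeal C = Ideal.span {(p : C)}) {ξ : MvPowerSeries σ C}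
    (hξ : IsDistinguished p ξ) : ξ ∉ maximalIdeal (MvPowerSeries σ C) ^ 2 := by
  obtain ⟨u, hu, hξu⟩ := hξ
  intro h
  have hle : maximalIdeal (MvPowerSeries σ C) ≤ (maximalIdeal C).comap constantCoeff :=
    fun f hf => (MvPowerSeries.mem_maximalIdeal_iff f).1 hf
  have h2 := (Ideal.pow_right_mono hle 2).trans (Ideal.le_comap_pow _ 2) h
  rw [Ideal.mem_comap, hξu, Ideal.mul_unit_mem_iff_mem _ hu, hm, Ideal.span_singleton_pow,
    Ideal.mem_span_singleton] at h2
  have hp0 : (p : C) ≠ 0 := fun h0 => IsDiscreteValuationRing.not_a_field C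
    (by rw [hm, h0, Ideal.span_singleton_eq_bot])
  obtain ⟨y, hy⟩ := h2
  have hpu : IsUnit (p : C) := IsUnit.of_mul_eq_one y (mul_left_cancel₀ hp0 (by
    rw [mul_one, ← mul_assoc, ← pow_two, ← hy]))
  have hpm : (p : C) ∈ maximalIdeal C := hm ▸ Ideal.mem_span_singleton_self _
  exact hpm hpu

/-- A nonzero kernel would make the dimension of the image, which is the whole ring, smaller. -/
theorem RingHom.injective_of_surjective_of_isDomain {A : Type*} [CommRing A] [IsDomain A]
    [IsLocalRing A] [IsNoetherianRing A] {f : A →+* A} (hf : Function.Surjective f) :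
    Function.Injective f := by
  refine (injective_iff_map_eq_zero f).2 fun b hb => ?_
  by_contra hb0
  have hdim := ringKrullDim_succ_le_of_surjective f hf (mem_nonZeroDivisors_of_ne_zero hb0) hb
  obtain ⟨n, hn⟩ : ∃ n : ℕ, ringKrullDim A = n := by
    rw [← maximalIdeal_height_eq_ringKrullDim]
    obtain ⟨n, hn⟩ := ENat.ne_top_iff_exists.1
      (Ideal.height_ne_top (maximalIdeal.isMaximal A).ne_top)
    exact ⟨n, by rw [← hn]; rfl⟩
  rw [hn] at hdim
  norm_cast at hdim
  lia

/-- An isomorphism `A / ξ' ≅ A / ξ` lifts to an endomorphism `f` of `A = C[[T₁, …, T_d]]` for which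
`f ξ'` is not in the square of the maximal ideal, so that it generates the same ideal as `ξ`. -/
theorem exists_ringHom_lift_notMem_sq (hp : p.Prime) (hC : IsCohenRing p k C) {d : ℕ}
    [IsDomain C] [IsDiscreteValuationRing C] {ξ ξ' : MvPowerSeries (Fin d) C}
    (hξ : IsDistinguished p ξ) (hξ' : IsDistinguished p ξ')
    (g : (MvPowerSeries (Fin d) C ⧸ Ideal.span {ξ'}) ≃+* MvPowerSeries (Fin d) C ⧸ Ideal.span {ξ}) :
    ∃ f : MvPowerSeries (Fin d) C →+* MvPowerSeries (Fin d) C,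
      (∀ a, Ideal.Quotient.mk (Ideal.span {ξ}) (f a) = g (Ideal.Quotient.mk _ a)) ∧
        f ξ' ∉ maximalIdeal (MvPowerSeries (Fin d) C) ^ 2 := by
  have : Fact p.Prime := ⟨hp⟩
  have := hC.isAdicComplete
  have hm := hC.maximalIdeal_eq
  have := isAdicComplete_maximalIdeal (σ := Fin d) hm
  set m := maximalIdeal (MvPowerSeries (Fin d) C)
  have hξm : ξ ∈ m := hξ.mem_maximalIdeal hm
  have hI : Ideal.span {ξ} ≤ m := (Ideal.span_singleton_le_iff_mem _).2 hξm
  have hI' : Ideal.span {ξ'} ≤ m := (Ideal.span_singleton_le_iff_mem _).2 (hξ'.mem_maximalIdeal hm)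
  have := isLocalRing_quotient_of_le_maximalIdeal hI
  have := isLocalRing_quotient_of_le_maximalIdeal hI'
  have hlocal := IsLocalHom.of_surjective (Ideal.Quotient.mk (Ideal.span {ξ}))
    Ideal.Quotient.mk_surjective
  have hlocal' := IsLocalHom.of_surjective (Ideal.Quotient.mk (Ideal.span {ξ'}))
    Ideal.Quotient.mk_surjective
  have hmap : ∀ a b, Ideal.Quotient.mk (Ideal.span {ξ}) b = g (Ideal.Quotient.mk _ a) →
      a ∈ m → b ∈ m := fun a b hab ha hb => ha <| by
    have h := hb.map (Ideal.Quotient.mk (Ideal.span {ξ}))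
    rw [hab] at h
    exact isUnit_of_map_unit (Ideal.Quotient.mk (Ideal.span {ξ'})) a
      ((MulEquiv.isUnit_map g).1 h)
  have hpm : (p : MvPowerSeries (Fin d) C) ∈ m := by
    rw [MvPowerSeries.mem_maximalIdeal_iff, map_natCast, hm]
    exact Ideal.mem_span_singleton_self _
  obtain ⟨h, hh⟩ := exists_lift_of_isAdicComplete hC.natCast_mem_nonZeroDivisors
    (hm ▸ maximalIdeal.isMaximal C) hpm hI
    ((g : _ →+* _).comp ((Ideal.Quotient.mk (Ideal.span {ξ'})).comp MvPowerSeries.C))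
  -- Any choice `t` of lifts of the images of the variables extends `h` to an endomorphism over `g`.
  have hlift : ∀ t : Fin d → MvPowerSeries (Fin d) C,
      (∀ i, Ideal.Quotient.mk (Ideal.span {ξ}) (t i) = g (Ideal.Quotient.mk _ (X i))) →
      ∃ f : MvPowerSeries (Fin d) C →+* MvPowerSeries (Fin d) C,
        (∀ c, f (MvPowerSeries.C c) = h c) ∧ (∀ i, f (X i) = t i) ∧
        ∀ a, Ideal.Quotient.mk (Ideal.span {ξ}) (f a) = g (Ideal.Quotient.mk _ a) := fun t ht => by
    have htm : ∀ i, t i ∈ m := fun i => hmap _ _ (ht i) (X_mem_maximalIdeal i)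
    obtain ⟨f, hfC, hfX⟩ := exists_ringHom_of_isAdicComplete (I := m) h t htm
    have heq : (Ideal.Quotient.mk (Ideal.span {ξ})).comp f =
        (g : _ →+* _).comp (Ideal.Quotient.mk (Ideal.span {ξ'})) := by
      refine ringHom_ext_of_isHausdorff (I := maximalIdeal _) inferInstance
        (fun c => ?_) (fun i => ?_) (fun i => ?_)
      · rw [RingHom.comp_apply, hfC, hh]; rfl
      · rw [RingHom.comp_apply, hfX, ht]; rfl
      · rw [RingHom.comp_apply, hfX]
        exact (map_mem_nonunits_iff (Ideal.Quotient.mk (Ideal.span {ξ})) (t i)).2 (htm i)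
    exact ⟨f, hfC, hfX, fun a => RingHom.congr_fun heq a⟩
  choose t ht using fun i => Ideal.Quotient.mk_surjective (I := Ideal.span {ξ})
    (g (Ideal.Quotient.mk _ (X i)))
  have htm : ∀ i, t i ∈ m := fun i => hmap _ _ (ht i) (X_mem_maximalIdeal i)
  obtain ⟨f₀, hf₀C, hf₀X, hf₀⟩ := hlift t ht
  by_cases h0 : f₀ ξ' ∉ m ^ 2
  · exact ⟨f₀, hf₀, h0⟩
  rw [not_not] at h0
  obtain ⟨u', hu', hξu'⟩ := hξ'
  obtain ⟨b, hb⟩ := Ideal.mem_span_range_iff_exists_fun.1 (sub_C_constantCoeff_mem_span_range_X ξ')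
  have hexp : ξ' = MvPowerSeries.C (p * u') + ∑ i, b i * X i := by
    rw [hb, ← hξu', add_sub_cancel]
  -- If all `b i` were in `m`, then `f₀ ξ'` would be congruent modulo `m ^ 2` to a unit times `p`.
  have hunit : ∃ j, IsUnit (b j) := by
    by_contra! hcon
    have hdist : IsDistinguished p (h (p * u')) := ⟨constantCoeff (h u'),
      (hu'.map h).map constantCoeff, by rw [map_mul, map_mul, map_natCast, map_natCast]⟩
    refine hdist.notMem_maximalIdeal_sq hm ?_
    have hsum : ∑ i, f₀ (b i) * t i ∈ m ^ 2 := sum_mem fun i _ => by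
      rw [pow_two]; exact Ideal.mul_mem_mul (hmap _ _ (hf₀ _) (hcon i)) (htm i)
    have : h (p * u') = f₀ ξ' - ∑ i, f₀ (b i) * t i := by
      simp only [hexp, map_add, map_sum, map_mul f₀, hf₀C, hf₀X, add_sub_cancel_right]
    rw [this]
    exact sub_mem h0 hsum
  obtain ⟨j, hj⟩ := hunit
  -- Changing `t j` by `ξ` changes the image of `ξ'` by `f₁ (b j) * ξ` modulo `m ^ 2`.
  obtain ⟨f₁, hf₁C, hf₁X, hf₁⟩ := hlift (t + Pi.single j ξ) fun i => by
    rw [Pi.add_apply, map_add, ht, add_eq_left, Ideal.Quotient.eq_zero_iff_mem]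
    obtain rfl | hij := eq_or_ne i j
    · rw [Pi.single_eq_same]; exact Ideal.mem_span_singleton_self _
    · rw [Pi.single_eq_of_ne hij]; exact zero_mem _
  refine ⟨f₁, hf₁, fun h1 => hξ.notMem_maximalIdeal_sq hm ?_⟩
  rw [← Ideal.unit_mul_mem_iff_mem _ (hj.map f₁)]
  have hdiff : f₁ (b j) * ξ = f₁ ξ' - f₀ ξ' - ∑ i, (f₁ (b i) - f₀ (b i)) * t i := by
    have hs : ∑ i, f₁ (b i) * (Pi.single j ξ : Fin d → MvPowerSeries (Fin d) C) i =
        f₁ (b j) * ξ := by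
      rw [Finset.sum_eq_single j (fun i _ hij => by rw [Pi.single_eq_of_ne hij, mul_zero])
        (fun hn => absurd (Finset.mem_univ j) hn), Pi.single_eq_same]
    simp only [hexp, map_add, map_sum, map_mul f₀, map_mul f₁, hf₀C, hf₀X, hf₁C, hf₁X,
      Pi.add_apply, mul_add, sub_mul, Finset.sum_add_distrib, Finset.sum_sub_distrib, hs]
    ring
  rw [hdiff]
  refine sub_mem (sub_mem h1 h0) (sum_mem fun i _ => ?_)
  rw [pow_two]
  refine Ideal.mul_mem_mul (hI (Ideal.Quotient.eq.1 ?_)) (htm i)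
  rw [hf₀, hf₁]

/-- An isomorphism between quotients of `C[[T₁, …, T_d]]` by distinguished elements comes from an
automorphism of `C[[T₁, …, T_d]]`. -/
theorem exists_ringEquiv_map_eq_of_quotient_equiv (hp : p.Prime) (hC : IsCohenRing p k C) {d : ℕ}
    {ξ ξ' : MvPowerSeries (Fin d) C} (hξ : IsDistinguished p ξ) (hξ' : IsDistinguished p ξ')
    (g : (MvPowerSeries (Fin d) C ⧸ Ideal.span {ξ'}) ≃+* MvPowerSeries (Fin d) C ⧸ Ideal.span {ξ}) :
    ∃ f : MvPowerSeries (Fin d) C ≃+* MvPowerSeries (Fin d) C,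
      (Ideal.span {ξ'}).map f = Ideal.span {ξ} := by
  have := hC.isDomain
  have := hC.isDiscreteValuationRing
  have := hC.isAdicComplete
  have hm := hC.maximalIdeal_eq
  have := isAdicComplete_maximalIdeal (σ := Fin d) hm
  have : IsDomain (MvPowerSeries (Fin d) C) := NoZeroDivisors.to_isDomain _
  obtain ⟨f, hf, hfξ⟩ := exists_ringHom_lift_notMem_sq hp hC hξ hξ' g
  set m := maximalIdeal (MvPowerSeries (Fin d) C)
  have hξm : ξ ∈ m := hξ.mem_maximalIdeal hm
  have hI : Ideal.span {ξ} ≤ m := (Ideal.span_singleton_le_iff_mem _).2 hξm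
  have hξ'm : ξ' ∈ m := hξ'.mem_maximalIdeal hm
  have hI' : Ideal.span {ξ'} ≤ m := (Ideal.span_singleton_le_iff_mem _).2 hξ'm
  have h0 : f ξ' ∈ Ideal.span {ξ} := by
    rw [← Ideal.Quotient.eq_zero_iff_mem, hf, Ideal.Quotient.eq_zero_iff_mem.2
      (Ideal.mem_span_singleton_self _), map_zero]
  obtain ⟨w, hw⟩ := Ideal.mem_span_singleton'.1 h0
  have hwu : IsUnit w := by
    by_contra hwu
    refine hfξ ?_
    rw [← hw, pow_two]
    exact Ideal.mul_mem_mul hwu hξm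
  have hspan : Ideal.span {f ξ'} = Ideal.span {ξ} := by
    rw [← hw]; exact Ideal.span_singleton_mul_left_unit hwu ξ
  have hlift : ∀ a, ∃ a', a - f a' ∈ Ideal.span {ξ} := fun a => by
    obtain ⟨a', ha'⟩ := Ideal.Quotient.mk_surjective (g.symm (Ideal.Quotient.mk _ a))
    exact ⟨a', by rw [← Ideal.Quotient.eq, hf, ha', g.apply_symm_apply]⟩
  have := isLocalRing_quotient_of_le_maximalIdeal hI'
  have hlocal' := IsLocalHom.of_surjective (Ideal.Quotient.mk (Ideal.span {ξ'}))
    Ideal.Quotient.mk_surjective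
  have hle : Ideal.span {ξ} ≤ m.map f := by
    rw [← hspan, Ideal.span_singleton_le_iff_mem]
    exact Ideal.mem_map_of_mem f hξ'm
  have hunit : ∀ a, IsUnit (f a) → IsUnit a := fun a ha => by
    have h := ha.map (Ideal.Quotient.mk (Ideal.span {ξ}))
    rw [hf] at h
    exact isUnit_of_map_unit (Ideal.Quotient.mk (Ideal.span {ξ'})) a ((MulEquiv.isUnit_map g).1 h)
  have hfm : m.map f = m := by
    refine le_antisymm (Ideal.map_le_iff_le_comap.2 fun a ha hfa => ha (hunit a hfa))
      fun a ha => ?_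
    obtain ⟨a', ha'⟩ := hlift a
    have hfa' : f a' ∈ m := by
      have := sub_mem ha (hI ha')
      rwa [sub_sub_cancel] at this
    rw [← sub_add_cancel a (f a')]
    exact add_mem (hle ha') (Ideal.mem_map_of_mem f fun hu => hfa' (hu.map f))
  have hsurj : Function.Surjective f := by
    have : IsHausdorff (m.map f) (MvPowerSeries (Fin d) C) := hfm.symm ▸ inferInstance
    refine surjective_of_mk_map_comp_surjective (I := m) f fun y => ?_
    obtain ⟨a, rfl⟩ := Ideal.Quotient.mk_surjective y
    obtain ⟨a', ha'⟩ := hlift a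
    exact ⟨a', (Ideal.Quotient.eq.2 (hle ha')).symm⟩
  refine ⟨RingEquiv.ofBijective f
    ⟨RingHom.injective_of_surjective_of_isDomain hsurj, hsurj⟩, ?_⟩
  rw [Ideal.map_span, Set.image_singleton]
  exact hspan

end Classification

/-! ### The classification -/

theorem mainTheorem9 (p : ℕ) (hp : p.Prime) (k : Type v) [Field k] [CharP k p]
    (C : Type u) [CommRing C] (hC : IsCohenRing p k C) (δC : DeltaStructure p C) (d : ℕ) :
    ∃ hR : ∀ I : PrismIdeal (δC.mvPowerSeries hp hC.natCast_mem_nonZeroDivisors (Fin d)),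
        IsCompleteRegularLocalRing k d (MvPowerSeries (Fin d) C ⧸ I.1),
      ∃ F : Quotient (PrismIdeal.setoid
            (δC.mvPowerSeries hp hC.natCast_mem_nonZeroDivisors (Fin d))) →
          Quotient (CompleteRegularLocalRing.setoid.{u, v} k d),
        (∀ I, F (Quotient.mk _ I) = Quotient.mk _ ⟨MvPowerSeries (Fin d) C ⧸ I.1, hR I⟩) ∧
          Function.Bijective F := by
  have := hC.isDomain
  have := hC.isDiscreteValuationRing
  have := hC.isAdicComplete
  have hm := hC.maximalIdeal_eq
  have hA := hC.natCast_mem_nonZeroDivisors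
  have hdist (I : PrismIdeal (δC.mvPowerSeries hp hA (Fin d))) :
      ∃ ξ, I.1 = Ideal.span {ξ} ∧ IsDistinguished p ξ := I.2.exists_isDistinguished hp hm hA δC
  have hR (I : PrismIdeal (δC.mvPowerSeries hp hA (Fin d))) :
      IsCompleteRegularLocalRing k d (MvPowerSeries (Fin d) C ⧸ I.1) := by
    obtain ⟨ξ, hI, hξ⟩ := hdist I
    rw [hI]
    exact hξ.isCompleteRegularLocalRing_quotient hC
  refine ⟨hR, Quotient.map (fun I => ⟨MvPowerSeries (Fin d) C ⧸ I.1, hR I⟩) ?_,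
    fun I => rfl, ?_, ?_⟩
  · rintro I I' ⟨f, hf⟩
    exact ⟨(Ideal.quotientEquiv I'.1 I.1 f hf.symm).symm⟩
  · intro I I' h
    induction I using Quotient.inductionOn with | h I => ?_
    induction I' using Quotient.inductionOn with | h I' => ?_
    obtain ⟨g⟩ := Quotient.exact h
    obtain ⟨ξ, hI, hξ⟩ := hdist I
    obtain ⟨ξ', hI', hξ'⟩ := hdist I'
    obtain ⟨J, hJ⟩ := I
    obtain ⟨J', hJ'⟩ := I'
    obtain rfl : J = Ideal.span {ξ} := hI
    obtain rfl : J' = Ideal.span {ξ'} := hI'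
    exact Quotient.sound (exists_ringEquiv_map_eq_of_quotient_equiv hp hC hξ hξ' g.symm)
  · intro R
    induction R using Quotient.inductionOn with | h R => ?_
    obtain ⟨ξ, hξ, ⟨e⟩⟩ := exists_isDistinguished_quotient_equiv hp hC R.property
    exact ⟨Quotient.mk _ ⟨Ideal.span {ξ}, hξ.isPrism hp hm hA δC⟩, Quotient.sound ⟨e⟩⟩
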